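/- Let $n \ge 2$, let $a_1,\dots,a_{n-1} \in \mathbb{R}\setminus\{0\}$, let $k_1,\dots,k_{n-1} \ge 2$ be integers, and put $$R(\xi') = \sum_{j=1}^{n-1} a_j \xi_j^{k_j}, \qquad \xi' = (\xi_1,\dots,\xi_{n-1}) \in \mathbb{R}^{n-1}.$$ Let $\hat\phi(\xi) = (2\pi)^{-n/2}\int_{\mathbb{R}^n} \phi(x) e^{-i x\cdot\xi}\,dx$, and let $1 \le p < \infty$. Then the Fourier restriction inequality for the hypersurface $S = \{\xi \in \mathbb{R}^n : \xi_n = R(\xi')\}$, $$\Big(\int_{\mathbb{R}^{n-1}} |\hat\phi(\xi', R(\xi'))|^2\, d\xi'\Big)^{1/2} \le C\, \|\phi\|_{L^p(\mathbb{R}^n)} \quad \text{for all } \phi \in L^p(\mathbb{R}^n),$$ holds with a constant $C$ independent of $\phi$ if and only if $$p = 2 - \frac{2}{2 + \sum_{j=1}^{n-1} \frac{1}{k_j}}.$$ Here, for $\phi \in L^p(\mathbb{R}^n)$ that is not integrable, the restriction of $\hat\phi$ to $S$ is understood through bounded linear extension: the inequality means that there is a bounded linear operator $T : L^p(\mathbb{R}^n)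 \to L^2(\mathbb{R}^{n-1})$, with $\|T\phi\|_{L^2} \le C\|\phi\|_{L^p}$ for all $\phi \in L^p(\mathbb{R}^n)$, such that $(T\phi)(\xi') = \hat\phi(\xi', R(\xi'))$ for almost every $\xi'$ whenever $\phi \in L^1(\mathbb{R}^n) \cap L^p(\mathbb{R}^n)$. -/

import Mathlib

open MeasureTheory

noncomputable section

/-- The Fourier transform `(2π)^(-n/2) ∫ f(x) exp(-i x·ξ) dx` on `ℝⁿ`
(the integral is meant for integrable `f`). -/
def fourierHat {n : ℕ} (f : EuclideanSpace ℝ (Fin n) → ℂ) (ξ : EuclideanSpace ℝ (Fin n)) : ℂ :=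
  (((2 * Real.pi) ^ (-(n : ℝ) / 2) : ℝ) : ℂ) *
    ∫ x, f x * Complex.exp (-Complex.I * ((∑ i, x i * ξ i : ℝ) : ℂ))

/-- The polynomial `R(ξ') = ∑ j, a j * ξ' j ^ k j` on `ℝᵐ`. -/
def monomialSum {m : ℕ} (a : Fin m → ℝ) (k : Fin m → ℕ) (ξ' : EuclideanSpace ℝ (Fin m)) : ℝ :=
  ∑ j, a j * ξ' j ^ k j

/-- The point `(ξ', R(ξ'))` of the graph of `R` in `ℝᵐ⁺¹`; the last coordinate is `R(ξ')`. -/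
def graphPoint {m : ℕ} (R : EuclideanSpace ℝ (Fin m) → ℝ) (ξ' : EuclideanSpace ℝ (Fin m)) :
    EuclideanSpace ℝ (Fin (m + 1)) :=
  WithLp.toLp 2 (Fin.snoc (α := fun _ => ℝ) (fun j => ξ' j) (R ξ'))

/-- The inequality `(∫ |φ̂(ξ', R(ξ'))|² dξ')^(1/2) ≤ C ‖φ‖_p` for all `φ ∈ L^p(ℝᵐ⁺¹)`, with a
constant `C` independent of `φ`.

If `φ ∈ L¹ ∩ L^p`, then `φ̂` is a continuous function, and `T φ` below has to be its restriction
to the graph, `ξ' ↦ φ̂(ξ', R(ξ'))`. For a general `φ ∈ L^p` the function `φ̂` has no pointwise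
values on the graph, and its restriction is understood, as usual, through the bounded linear
extension `T` to `L^p`; it is unique for `1 ≤ p < ∞`, since `L¹ ∩ L^p` is dense in `L^p`.
The norms are the `L²(ℝᵐ)` and the `L^p(ℝᵐ⁺¹)` norm for Lebesgue measure. -/
def RestrictionInequality {m : ℕ} (R : EuclideanSpace ℝ (Fin m) → ℝ) (p : ℝ) : Prop :=
  ∃ (C : ℝ) (T : Lp ℂ (ENNReal.ofReal p) (volume : Measure (EuclideanSpace ℝ (Fin (m + 1)))) →ₗ[ℂ]
      Lp ℂ 2 (volume : Measure (EuclideanSpace ℝ (Fin m)))),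
    (∀ φ : Lp ℂ (ENNReal.ofReal p) (volume : Measure (EuclideanSpace ℝ (Fin (m + 1)))),
      Integrable φ volume →
      (T φ : EuclideanSpace ℝ (Fin m) → ℂ) =ᵐ[volume]
        fun ξ' => fourierHat (φ : EuclideanSpace ℝ (Fin (m + 1)) → ℂ) (graphPoint R ξ')) ∧
    ∀ φ, ‖T φ‖ ≤ C * ‖φ‖

end

/-! Write h for the sum of the 1/k_j. Sufficiency is a TT* argument in the last physical variable t.
With f_t = f(·, t), the squared L² norm of the restriction is the double integral over s and t of
⟨U(s - t) f_s, f_t⟩, where U(τ) is the Fourier multiplier e^{-iτR}. Its kernel factors into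
one-dimensional oscillatory integrals, and van der Corput (`norm_integral_cexp_pow_le`) bounds the
j-th by a multiple of |τ|^{-1/k_j}, uniformly in the linear part of the phase. So U(τ) has an L¹ ×
L¹ bound of order |τ|^{-h}. Plancherel gives an L² × L² bound independent of τ, and interpolation
(`riesz_thorin_bilinear`) an Lᵖ × Lᵖ bound of order |τ|^{-h(2/p - 1)}. The remaining double integral
in time is controlled by `hardy_littlewood_sobolev_diagonal`, provided that h(2/p - 1) = 2 - 2/p,
which is exactly the stated value of p.

Interpolation is carried out for finite sums, so the estimate is first proved for step functions,
with frequencies cut off to cubes so that Fubini applies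
(`lintegral_enorm_graphFourier_stepFun_le`). The constants do not see the cut-off. Fatou's lemma
then gives all integrable functions, and density gives Lᵖ (`restrictionInequality_of_le`).

Necessity is scaling: the graph is invariant under ξ_j ↦ l^{1/k_j} ξ_j, ξ_n ↦ l ξ_n. The transform
of the indicator of a box with sides l^{-1/k_j} and l^{-1} is comparable to the volume l^{-(1+h)} on
a dual box of volume comparable to l^h. The inequality therefore bounds a fixed power of l for all l
> 0, small and large, so its exponent must vanish (`exponent_eq_of_restrictionInequality`). -/

/-! ### Van der Corput estimates -/

section OscillatoryIntegrals

open Complex in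
/-- First derivative test for oscillatory integrals with increasing phase derivative. -/
theorem norm_integral_cexp_le_of_deriv_ge {φ ψ χ : ℝ → ℝ} (hφ : ∀ x, HasDerivAt φ (ψ x) x)
    (hψ : ∀ x, HasDerivAt ψ (χ x) x) (hχ : Continuous χ) {a b ρ : ℝ} (hab : a ≤ b) (hρ : 0 < ρ)
    (hge : ∀ x ∈ Set.Icc a b, ρ ≤ ψ x) (hmono : ∀ x ∈ Set.Icc a b, 0 ≤ χ x) :
    ‖∫ x in a..b, cexp (I * (φ x : ℝ))‖ ≤ 3 / ρ := by
  have hψc : Continuous ψ := continuous_iff_continuousAt.2 fun x => (hψ x).continuousAt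
  have hφc : Continuous φ := continuous_iff_continuousAt.2 fun x => (hφ x).continuousAt
  have hpos : ∀ x ∈ Set.Icc a b, 0 < ψ x := fun x hx => hρ.trans_le (hge x hx)
  have hu : Set.uIcc a b = Set.Icc a b := Set.uIcc_of_le hab
  have hv : ∀ x ∈ Set.uIcc a b, HasDerivAt (fun x => cexp (I * (φ x : ℝ)))
      (cexp (I * (φ x : ℝ)) * (I * (ψ x : ℝ))) x := fun x _ =>
    (((hφ x).ofReal_comp).const_mul I).cexp
  have hinv : ∀ x ∈ Set.uIcc a b, HasDerivAt (fun x => (ψ x)⁻¹) (-χ x / ψ x ^ 2) x := by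
    intro x hx
    exact (hψ x).inv (hpos x (hu ▸ hx)).ne'
  have huD : ∀ x ∈ Set.uIcc a b, HasDerivAt (fun x => -I * (((ψ x)⁻¹ : ℝ) : ℂ))
      (-I * ((-χ x / ψ x ^ 2 : ℝ) : ℂ)) x := fun x hx =>
    ((hinv x hx).ofReal_comp).const_mul (-I)
  have hci : ContinuousOn (fun x => -χ x / ψ x ^ 2) (Set.uIcc a b) := by
    rw [hu]
    exact hχ.neg.continuousOn.div (hψc.pow 2).continuousOn
      fun x hx => (pow_pos (hpos x hx) 2).ne'
  have hii : IntervalIntegrable (fun x => -χ x / ψ x ^ 2) volume a b :=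
    hci.intervalIntegrable
  -- Integration by parts, with the integrand written as (-i/ψ) times the derivative of e^{iφ}.
  have hparts := intervalIntegral.integral_mul_deriv_eq_deriv_mul huD hv
    (ContinuousOn.intervalIntegrable (by fun_prop))
    (Continuous.intervalIntegrable (by fun_prop) _ _)
  have hL : ∫ x in a..b, cexp (I * (φ x : ℝ)) =
      ∫ x in a..b, (-I * (((ψ x)⁻¹ : ℝ) : ℂ)) * (cexp (I * (φ x : ℝ)) * (I * (ψ x : ℝ))) := by
    refine intervalIntegral.integral_congr fun x hx => ?_
    have h0 : (ψ x : ℂ) ≠ 0 := by exact_mod_cast (hpos x (hu ▸ hx)).ne'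
    push_cast
    field_simp
    simp [I_sq]
  have hn : ∀ x : ℝ, ‖cexp (I * (x : ℝ))‖ = 1 := fun x => by
    rw [mul_comm]; exact norm_exp_ofReal_mul_I x
  have hle : ∀ x ∈ Set.Icc a b, (ψ x)⁻¹ ≤ 1 / ρ := fun x hx => by
    rw [one_div]; exact inv_anti₀ hρ (hge x hx)
  have hb : ∀ x ∈ Set.Icc a b, ‖-I * (((ψ x)⁻¹ : ℝ) : ℂ) * cexp (I * (φ x : ℝ))‖ ≤ 1 / ρ := by
    intro x hx
    rw [norm_mul, norm_mul, hn, norm_neg, norm_I, Complex.norm_real, Real.norm_eq_abs,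
      abs_of_pos (inv_pos.2 (hpos x hx))]
    simpa using hle x hx
  -- As χ ≥ 0, the function 1/ψ is decreasing, so the integral of |(1/ψ)'| telescopes to at most
  -- 1/ρ. The two boundary terms supply the rest of 3/ρ.
  have hint : ‖∫ x in a..b, -I * ((-χ x / ψ x ^ 2 : ℝ) : ℂ) * cexp (I * (φ x : ℝ))‖ ≤ 1 / ρ := by
    refine (intervalIntegral.norm_integral_le_integral_norm hab).trans ?_
    have : ∫ x in a..b, ‖-I * ((-χ x / ψ x ^ 2 : ℝ) : ℂ) * cexp (I * (φ x : ℝ))‖ =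
        ∫ x in a..b, -(-χ x / ψ x ^ 2) := by
      refine intervalIntegral.integral_congr fun x hx => ?_
      have h1 : 0 ≤ χ x / ψ x ^ 2 := div_nonneg (hmono x (hu ▸ hx)) (sq_nonneg _)
      simp only [norm_mul, hn, norm_neg, norm_I, Complex.norm_real, Real.norm_eq_abs, neg_div,
        abs_of_nonneg h1]
      ring
    rw [this, intervalIntegral.integral_neg,
      intervalIntegral.integral_eq_sub_of_hasDerivAt hinv hii]
    have h1 := hle a (Set.left_mem_Icc.2 hab)
    have h2 := inv_pos.2 (hpos b (Set.right_mem_Icc.2 hab))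
    linarith
  rw [hL, hparts]
  refine (norm_sub_le _ _).trans ?_
  have h1 := norm_sub_le (-I * (((ψ b)⁻¹ : ℝ) : ℂ) * cexp (I * (φ b : ℝ)))
    (-I * (((ψ a)⁻¹ : ℝ) : ℂ) * cexp (I * (φ a : ℝ)))
  have h2 := hb a (Set.left_mem_Icc.2 hab)
  have h3 := hb b (Set.right_mem_Icc.2 hab)
  have : 3 / ρ = 1 / ρ + 1 / ρ + 1 / ρ := by ring
  linarith

open Complex in
theorem norm_integral_cexp_le_sub (φ : ℝ → ℝ) {a b : ℝ} (hab : a ≤ b) :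
    ‖∫ x in a..b, cexp (I * (φ x : ℝ))‖ ≤ b - a := by
  have := intervalIntegral.norm_integral_le_of_norm_le_const (a := a) (b := b) (C := 1)
    (f := fun x => cexp (I * (φ x : ℝ)))
    (fun x _ => by rw [mul_comm]; exact (norm_exp_ofReal_mul_I (φ x)).le)
  rwa [one_mul, abs_of_nonneg (sub_nonneg.2 hab)] at this

-- The interval is cut at a + 1/ρ. The first piece is bounded by its length. On the second, ψ has
-- grown from a nonnegative value at rate at least ρ² over a length at least 1/ρ, so ψ ≥ ρ and the
-- first derivative test gives 3/ρ.
open Complex in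
theorem norm_integral_cexp_le_of_deriv_nonneg {φ ψ χ : ℝ → ℝ} (hφ : ∀ x, HasDerivAt φ (ψ x) x)
    (hψ : ∀ x, HasDerivAt ψ (χ x) x) (hχ : Continuous χ) {a b ρ : ℝ} (hab : a ≤ b) (hρ : 0 < ρ)
    (h0 : 0 ≤ ψ a) (hge : ∀ x ∈ Set.Icc a b, ρ ^ 2 ≤ χ x) :
    ‖∫ x in a..b, cexp (I * (φ x : ℝ))‖ ≤ 4 / ρ := by
  have hφc : Continuous φ := continuous_iff_continuousAt.2 fun x => (hφ x).continuousAt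
  have hc : Continuous fun x => cexp (I * (φ x : ℝ)) := by fun_prop
  have h43 : 4 / ρ = 1 / ρ + 3 / ρ := by ring
  have h3 : 0 < 3 / ρ := by positivity
  have h1 : 0 < 1 / ρ := by positivity
  rcases le_total b (a + 1 / ρ) with hb | hb
  · have := norm_integral_cexp_le_sub φ hab
    linarith
  · have hac : a ≤ a + 1 / ρ := by linarith
    rw [← intervalIntegral.integral_add_adjacent_intervals (b := a + 1 / ρ)
      (hc.intervalIntegrable _ _) (hc.intervalIntegrable _ _), h43]
    refine (norm_add_le _ _).trans (add_le_add ?_ ?_)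
    · have := norm_integral_cexp_le_sub φ hac
      linarith
    · refine norm_integral_cexp_le_of_deriv_ge hφ hψ hχ hb hρ (fun x hx => ?_)
        (fun x hx => (sq_nonneg ρ).trans (hge x ⟨hac.trans hx.1, hx.2⟩))
      have hax : a < x := by linarith [hx.1]
      obtain ⟨c, hc, hc'⟩ := exists_hasDerivAt_eq_slope ψ χ hax
        (fun y _ => (hψ y).continuousAt.continuousWithinAt) (fun y _ => hψ y)
      have h5 := hge c ⟨hc.1.le, hc.2.le.trans hx.2⟩
      rw [hc', le_div_iff₀ (by linarith)] at h5
      have h6 : 1 / ρ ≤ x - a := by linarith [hx.1]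
      have h7 : ρ ^ 2 * (1 / ρ) ≤ ρ ^ 2 * (x - a) := by gcongr
      have h8 : ρ ^ 2 * (1 / ρ) = ρ := by field_simp
      linarith

open Complex in
/-- Second derivative test for oscillatory integrals. -/
theorem norm_integral_cexp_le_of_deriv2_ge {φ ψ χ : ℝ → ℝ} (hφ : ∀ x, HasDerivAt φ (ψ x) x)
    (hψ : ∀ x, HasDerivAt ψ (χ x) x) (hχ : Continuous χ) {a b ρ : ℝ} (hab : a ≤ b) (hρ : 0 < ρ)
    (hge : ∀ x ∈ Set.Icc a b, ρ ^ 2 ≤ χ x) :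
    ‖∫ x in a..b, cexp (I * (φ x : ℝ))‖ ≤ 8 / ρ := by
  have hφc : Continuous φ := continuous_iff_continuousAt.2 fun x => (hφ x).continuousAt
  have hψc : Continuous ψ := continuous_iff_continuousAt.2 fun x => (hψ x).continuousAt
  have hc : Continuous fun x => cexp (I * (φ x : ℝ)) := by fun_prop
  have h84 : 8 / ρ = 4 / ρ + 4 / ρ := by ring
  have h4 : 0 < 4 / ρ := by positivity
  -- The reflection x ↦ -x turns ψ ≤ 0 at the right endpoint into a nonnegative derivative at the
  -- left endpoint and preserves χ.
  have hrefl : ∀ c, c ∈ Set.Icc a b → ψ c ≤ 0 →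
      ‖∫ x in a..c, cexp (I * (φ x : ℝ))‖ ≤ 4 / ρ := by
    intro c hcm hc0
    have h1 : ∀ x, HasDerivAt (fun x => φ (-x)) (-ψ (-x)) x := fun x => by
      simpa [Function.comp_def] using (hφ (-x)).scomp x (hasDerivAt_neg x)
    have h2 : ∀ x, HasDerivAt (fun x => -ψ (-x)) (χ (-x)) x := fun x => by
      simpa [Function.comp_def] using ((hψ (-x)).scomp x (hasDerivAt_neg x)).fun_neg
    have := norm_integral_cexp_le_of_deriv_nonneg h1 h2 (by fun_prop) (a := -c) (b := -a)
      (neg_le_neg hcm.1) hρ (by simpa using hc0)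
      (fun x hx => hge (-x) ⟨by linarith [hx.2], by linarith [hx.1, hcm.2]⟩)
    rwa [intervalIntegral.integral_comp_neg (fun x => cexp (I * (φ x : ℝ))), neg_neg,
      neg_neg] at this
  rcases le_total 0 (ψ a) with ha | ha
  · have := norm_integral_cexp_le_of_deriv_nonneg hφ hψ hχ hab hρ ha hge
    linarith
  rcases le_total (ψ b) 0 with hb | hb
  · have := hrefl b (Set.right_mem_Icc.2 hab) hb
    linarith
  obtain ⟨c, hcm, hc0⟩ := intermediate_value_Icc hab hψc.continuousOn ⟨ha, hb⟩
  rw [← intervalIntegral.integral_add_adjacent_intervals (b := c)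
      (hc.intervalIntegrable _ _) (hc.intervalIntegrable _ _), h84]
  exact (norm_add_le _ _).trans (add_le_add (hrefl c hcm hc0.le)
    (norm_integral_cexp_le_of_deriv_nonneg hφ hψ hχ hcm.2 hρ hc0.ge
      fun x hx => hge x ⟨hcm.1.trans hx.1, hx.2⟩))

-- At the scale δ = α^{-1/k} the term αx^k has size 1. Up to δ the length bound suffices. Beyond it
-- the second derivative is at least αδ^{k-2} = δ^{-2}, and the second derivative test gives 8δ. The
-- linear term does not enter the second derivative, hence the uniformity in β.
open Complex in
theorem norm_integral_cexp_pow_le_of_pos {k : ℕ} (hk : 2 ≤ k) {α : ℝ} (hα : 0 < α) (β : ℝ) {N : ℝ}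
    (hN : 0 ≤ N) :
    ‖∫ x in (0 : ℝ)..N, cexp (I * (α * x ^ k + β * x : ℝ))‖ ≤ 9 * α ^ (-(1 / k : ℝ)) := by
  set δ : ℝ := α ^ (-(1 / k : ℝ)) with hδ
  have hδ0 : 0 < δ := Real.rpow_pos_of_pos hα _
  have hc : Continuous fun x : ℝ => cexp (I * (α * x ^ k + β * x : ℝ)) := by fun_prop
  rcases le_total N δ with h | h
  · have := norm_integral_cexp_le_sub (fun x => α * x ^ k + β * x) hN
    linarith
  obtain ⟨j, rfl⟩ : ∃ j, k = j + 2 := ⟨k - 2, by omega⟩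
  have hδk : α * δ ^ (j + 2) = 1 := by
    rw [hδ, ← Real.rpow_natCast, ← Real.rpow_mul hα.le]
    have : (-(1 / ((j + 2 : ℕ) : ℝ)) * ((j + 2 : ℕ) : ℝ)) = -1 := by
      have : ((j + 2 : ℕ) : ℝ) ≠ 0 := by positivity
      field_simp
    rw [this, Real.rpow_neg_one, mul_inv_cancel₀ hα.ne']
  rw [← intervalIntegral.integral_add_adjacent_intervals (b := δ)
      (hc.intervalIntegrable _ _) (hc.intervalIntegrable _ _)]
  have h1 := norm_integral_cexp_le_sub (fun x => α * x ^ (j + 2) + β * x) hδ0.le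
  have hφ : ∀ x : ℝ, HasDerivAt (fun x => α * x ^ (j + 2) + β * x)
      (α * ((j + 2 : ℕ) * x ^ (j + 1)) + β) x := fun x => by
    simpa using ((hasDerivAt_pow (j + 2) x).const_mul α).fun_add ((hasDerivAt_id x).const_mul β)
  have hψ : ∀ x : ℝ, HasDerivAt (fun x => α * ((j + 2 : ℕ) * x ^ (j + 1)) + β)
      (α * ((j + 2 : ℕ) * ((j + 1 : ℕ) * x ^ j))) x := fun x => by
    simpa using (((hasDerivAt_pow (j + 1) x).const_mul ((j + 2 : ℕ) : ℝ)).const_mul α).add_const β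
  have h2 := norm_integral_cexp_le_of_deriv2_ge hφ hψ (by fun_prop) h (inv_pos.2 hδ0)
    (fun x hx => ?_)
  · rw [div_inv_eq_mul] at h2
    refine (norm_add_le _ _).trans ?_
    linarith
  · have h3 : (δ⁻¹) ^ 2 = α * δ ^ j := by
      have : δ ^ (j + 2) = δ ^ j * δ ^ 2 := pow_add _ _ _
      rw [this] at hδk
      field_simp
      linarith
    have h4 : δ ^ j ≤ x ^ j := pow_le_pow_left₀ hδ0.le hx.1 j
    have h5 : (1 : ℝ) ≤ ((j + 2 : ℕ) : ℝ) := by exact_mod_cast (by omega : 1 ≤ j + 2)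
    have h6 : (1 : ℝ) ≤ ((j + 1 : ℕ) : ℝ) := by exact_mod_cast (by omega : 1 ≤ j + 1)
    have h7 : 0 ≤ x ^ j := (pow_pos hδ0 j).le.trans h4
    rw [h3]
    refine mul_le_mul_of_nonneg_left (h4.trans ?_) hα.le
    calc x ^ j ≤ (j + 1 : ℕ) * x ^ j := le_mul_of_one_le_left h7 h6
      _ ≤ _ := le_mul_of_one_le_left (by positivity) h5

-- Complex conjugation negates the phase, which reduces negative α to positive α.
open Complex in
theorem norm_integral_cexp_pow_le_half {k : ℕ} (hk : 2 ≤ k) {α : ℝ} (hα : α ≠ 0) (β : ℝ) {N : ℝ}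
    (hN : 0 ≤ N) :
    ‖∫ x in (0 : ℝ)..N, cexp (I * (α * x ^ k + β * x : ℝ))‖ ≤ 9 * |α| ^ (-(1 / k : ℝ)) := by
  rcases hα.lt_or_gt with h | h
  · have := norm_integral_cexp_pow_le_of_pos hk (neg_pos.2 h) (-β) hN
    rw [abs_of_neg h]
    refine le_trans (le_of_eq ?_) this
    rw [← Complex.norm_conj, intervalIntegral.integral_of_le hN, intervalIntegral.integral_of_le hN,
      ← integral_conj]
    congr 2
    ext x
    rw [← exp_conj]
    congr 1
    simp
    ring
  · rw [abs_of_pos h]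
    exact norm_integral_cexp_pow_le_of_pos hk h β hN

open Complex in
/-- Van der Corput's estimate for the phases `α x ^ k + β x`. -/
theorem norm_integral_cexp_pow_le {k : ℕ} (hk : 2 ≤ k) {α : ℝ} (hα : α ≠ 0) (β : ℝ) {N : ℝ}
    (hN : 0 ≤ N) :
    ‖∫ x in (-N)..N, cexp (I * (α * x ^ k + β * x : ℝ))‖ ≤ 18 * |α| ^ (-(1 / k : ℝ)) := by
  have hc : Continuous fun x : ℝ => cexp (I * (α * x ^ k + β * x : ℝ)) := by fun_prop
  rw [← intervalIntegral.integral_add_adjacent_intervals (b := 0)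
      (hc.intervalIntegrable _ _) (hc.intervalIntegrable _ _)]
  have h1 := norm_integral_cexp_pow_le_half hk hα β hN
  -- Folding the negative half by x ↦ -x changes α into α(-1)^k, which has the same absolute value.
  have h2 := norm_integral_cexp_pow_le_half hk (α := α * (-1) ^ k)
    (mul_ne_zero hα (by positivity)) (-β) hN
  have h3 : ∫ x in (-N)..0, cexp (I * (α * x ^ k + β * x : ℝ)) =
      ∫ x in (0 : ℝ)..N, cexp (I * (α * (-1) ^ k * x ^ k + -β * x : ℝ)) := by
    have := intervalIntegral.integral_comp_neg (a := 0) (b := N)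
      (fun x => cexp (I * (α * x ^ k + β * x : ℝ)))
    rw [neg_zero] at this
    rw [← this]
    congr 1
    ext x
    rw [neg_pow x k]
    congr 3
    ring
  rw [abs_mul, abs_pow, abs_neg, abs_one, one_pow, mul_one] at h2
  rw [h3]
  refine (norm_add_le _ _).trans ?_
  linarith

end OscillatoryIntegrals

/-! ### Complex interpolation of bilinear forms -/

section RieszThorin

/-- The entire family `z ↦ sgn(c) ‖c‖ ^ (p (1 + z) / 2)` used for complex interpolation. -/
noncomputable def phasePow (p : ℝ) (c z : ℂ) : ℂ :=
  if c = 0 then 0 else c / ‖c‖ * (‖c‖ : ℂ) ^ ((p : ℂ) * (1 + z) / 2)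

/-- The exponent must be nonzero because `phasePow` vanishes at `c = 0`, whereas `0 ^ 0 = 1`. -/
theorem norm_phasePow {p : ℝ} {c z : ℂ} (h : p * (1 + z.re) / 2 ≠ 0) :
    ‖phasePow p c z‖ = ‖c‖ ^ (p * (1 + z.re) / 2) := by
  unfold phasePow
  split_ifs with hc
  · simp [hc, Real.zero_rpow h]
  · have h0 : 0 < ‖c‖ := norm_pos_iff.2 hc
    rw [norm_mul, norm_div, Complex.norm_real, norm_norm, div_self h0.ne', one_mul,
      Complex.norm_cpow_eq_rpow_re_of_pos h0]
    congr 1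
    simp

theorem phasePow_of_eq {p : ℝ} {c z : ℂ} (h : (p : ℂ) * (1 + z) / 2 = 1) : phasePow p c z = c := by
  unfold phasePow
  split_ifs with hc
  · exact hc.symm
  · have h0 : (‖c‖ : ℂ) ≠ 0 := by simpa using hc
    rw [h, Complex.cpow_one, div_mul_cancel₀ _ h0]

theorem differentiable_phasePow (p : ℝ) (c : ℂ) : Differentiable ℂ (phasePow p c) := by
  by_cases hc : c = 0
  · have : phasePow p c = fun _ => 0 := by ext z; simp [phasePow, hc]
    rw [this]; exact differentiable_const _
  · have h0 : (‖c‖ : ℂ) ≠ 0 := by simpa using hc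
    have : phasePow p c = fun z => c / ‖c‖ * (‖c‖ : ℂ) ^ ((p : ℂ) * (1 + z) / 2) := by
      ext z; simp [phasePow, hc]
    rw [this]
    refine Differentiable.const_mul (Differentiable.const_cpow (by fun_prop) (Or.inl h0)) _

theorem norm_phasePow_le {p : ℝ} (hp : 0 < p) (c z : ℂ) (h0 : 0 ≤ z.re) (h1 : z.re ≤ 1) :
    ‖phasePow p c z‖ ≤ (1 + ‖c‖) ^ p := by
  rw [norm_phasePow (by positivity)]
  calc ‖c‖ ^ (p * (1 + z.re) / 2) ≤ (1 + ‖c‖) ^ (p * (1 + z.re) / 2) :=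
        Real.rpow_le_rpow (norm_nonneg _) (by linarith [norm_nonneg c]) (by positivity)
    _ ≤ (1 + ‖c‖) ^ p := Real.rpow_le_rpow_of_exponent_le (by linarith [norm_nonneg c]) (by nlinarith)

/-- **Riesz–Thorin interpolation** between `L¹ × L¹` and `L² × L²` bounds, for a bilinear form on
finite weighted `ℓᵖ` spaces. -/
theorem riesz_thorin_bilinear {ι κ : Type*} [Fintype ι] [Fintype κ] (b : ι → κ → ℂ)
    {μ : ι → ℝ} {ν : κ → ℝ} (hμ : ∀ i, 0 ≤ μ i) (hν : ∀ j, 0 ≤ ν j) {A₁ A₂ : ℝ} (hA₁ : 0 ≤ A₁)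
    (hA₂ : 0 ≤ A₂)
    (H₁ : ∀ (c : ι → ℂ) (d : κ → ℂ), ‖∑ i, ∑ j, c i * d j * b i j‖ ≤ A₁ * ((∑ i, ‖c i‖ * μ i) * ∑ j, ‖d j‖ * ν j))
    (H₂ : ∀ (c : ι → ℂ) (d : κ → ℂ), ‖∑ i, ∑ j, c i * d j * b i j‖ ≤
      A₂ * ((∑ i, ‖c i‖ ^ 2 * μ i) * ∑ j, ‖d j‖ ^ 2 * ν j) ^ (1 / 2 : ℝ))
    {p : ℝ} (hp1 : 1 < p) (hp2 : p < 2) (c : ι → ℂ) (d : κ → ℂ) :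
    ‖∑ i, ∑ j, c i * d j * b i j‖ ≤ A₂ ^ (2 - 2 / p) * A₁ ^ (2 / p - 1) *
      ((∑ i, ‖c i‖ ^ p * μ i) * ∑ j, ‖d j‖ ^ p * ν j) ^ (1 / p) := by
  have hp0 : 0 < p := by linarith
  -- At z = θ the exponent p(1 + z)/2 is 1, so `F θ` is the form to be bounded. On Re z = 0 the
  -- squared moduli, and on Re z = 1 the moduli themselves, are the p-th powers ‖c‖^p and ‖d‖^p, so
  -- `H₂` and `H₁` apply there.
  set θ : ℝ := 2 / p - 1 with hθ
  set F : ℂ → ℂ := fun z => ∑ i, ∑ j, phasePow p (c i) z * phasePow p (d j) z * b i j with hF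
  set M : ℝ := (∑ i, ‖c i‖ ^ p * μ i) * ∑ j, ‖d j‖ ^ p * ν j with hM
  have hM0 : 0 ≤ M := mul_nonneg
    (Finset.sum_nonneg fun i _ => mul_nonneg (Real.rpow_nonneg (norm_nonneg _) _) (hμ i))
    (Finset.sum_nonneg fun i _ => mul_nonneg (Real.rpow_nonneg (norm_nonneg _) _) (hν i))
  have hdiff : Differentiable ℂ F :=
    Differentiable.fun_sum fun i _ => Differentiable.fun_sum fun j _ =>
      ((differentiable_phasePow p (c i)).mul (differentiable_phasePow p (d j))).mul_const _
  have hFθ : F θ = ∑ i, ∑ j, c i * d j * b i j := by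
    have : (p : ℂ) * (1 + (θ : ℝ)) / 2 = 1 := by
      have hp' : (p : ℂ) ≠ 0 := by exact_mod_cast hp0.ne'
      rw [hθ]; push_cast; field_simp; ring
    simp only [hF, phasePow_of_eq this]
  have hθ0 : 0 ≤ θ := by rw [hθ, sub_nonneg, le_div_iff₀ hp0]; linarith
  have hθ1 : θ ≤ 1 := by rw [hθ, sub_le_iff_le_add, div_le_iff₀ hp0]; linarith
  have hbdd : BddAbove ((norm ∘ F) '' Complex.HadamardThreeLines.verticalClosedStrip 0 1) := by
    refine ⟨∑ i, ∑ j, (1 + ‖c i‖) ^ p * (1 + ‖d j‖) ^ p * ‖b i j‖, ?_⟩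
    rintro _ ⟨z, hz, rfl⟩
    refine (norm_sum_le _ _).trans (Finset.sum_le_sum fun i _ => (norm_sum_le _ _).trans
      (Finset.sum_le_sum fun j _ => ?_))
    rw [norm_mul, norm_mul]
    gcongr
    · exact norm_phasePow_le hp0 _ _ hz.1 hz.2
    · exact norm_phasePow_le hp0 _ _ hz.1 hz.2
  have h0 : ∀ z ∈ Complex.re ⁻¹' {(0 : ℝ)}, ‖F z‖ ≤ A₂ * M ^ (1 / 2 : ℝ) := by
    intro z hz
    have hz : z.re = 0 := hz
    refine (H₂ _ _).trans (le_of_eq ?_)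
    have : ∀ c : ℂ, ‖phasePow p c z‖ ^ 2 = ‖c‖ ^ p := fun c => by
      rw [norm_phasePow (by rw [hz]; positivity), ← Real.rpow_natCast,
        ← Real.rpow_mul (norm_nonneg _), hz]
      congr 1; push_cast; ring
    simp only [this, hM]
  have h1 : ∀ z ∈ Complex.re ⁻¹' {(1 : ℝ)}, ‖F z‖ ≤ A₁ * M := by
    intro z hz
    have hz : z.re = 1 := hz
    refine (H₁ _ _).trans (le_of_eq ?_)
    have : ∀ c : ℂ, ‖phasePow p c z‖ = ‖c‖ ^ p := fun c => by
      rw [norm_phasePow (by rw [hz]; positivity), hz]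
      congr 1; ring
    simp only [this, hM]
  have key := Complex.HadamardThreeLines.norm_le_interp_of_mem_verticalClosedStrip₀₁' F
    (z := (θ : ℂ)) ⟨by simpa using hθ0, by simpa using hθ1⟩ hdiff.diffContOnCl hbdd h0 h1
  rw [hFθ, Complex.ofReal_re] at key
  refine key.trans (le_of_eq ?_)
  rw [Real.mul_rpow hA₂ (Real.rpow_nonneg hM0 _), Real.mul_rpow hA₁ hM0, ← Real.rpow_mul hM0]
  have h2 : 1 - θ = 2 - 2 / p := by rw [hθ]; ring
  have h3 : M ^ (1 / p) = M ^ (1 / 2 * (1 - θ)) * M ^ θ := by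
    rw [← Real.rpow_add_of_nonneg hM0 (by linarith) hθ0]
    congr 1; rw [hθ]; ring
  rw [h3, ← h2]; ring

end RieszThorin

/-! ### Plancherel's identity for the Fourier integral -/

section Plancherel

open FourierTransform in
open scoped ContDiff in
/-- On `L¹ ∩ L²` the `L²` Fourier transform is given by the Fourier integral. -/
theorem fourier_toLp_ae_eq {E : Type*} [NormedAddCommGroup E] [InnerProductSpace ℝ E]
    [FiniteDimensional ℝ E] [MeasurableSpace E] [BorelSpace E] {f : E → ℂ}
    (hf : Integrable f) (hf2 : MemLp f 2) :
    (𝓕 (hf2.toLp f) : Lp ℂ 2 (volume : Measure E)) =ᵐ[volume] 𝓕 f := by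
  have hcont : Continuous (𝓕 f) := VectorFourier.fourierIntegral_continuous
    Real.continuous_fourierChar (by exact continuous_inner) hf
  -- Both sides are tested against smooth compactly supported `g`. The transform passes to `g` on
  -- one side by compatibility with tempered distributions, on the other by the multiplication
  -- formula for Fourier integrals.
  refine ae_eq_of_integral_contDiff_smul_eq
    ((Lp.memLp _).locallyIntegrable (by norm_num)) hcont.locallyIntegrable fun g hg hgc => ?_
  have hg1 : ContDiff ℝ ∞ (fun x => (g x : ℂ)) := Complex.ofRealCLM.contDiff.comp hg
  have hg2 : HasCompactSupport (fun x => (g x : ℂ)) := hgc.comp_left (g := fun r : ℝ => (r : ℂ)) rfl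
  set G := hg2.toSchwartzMap hg1 with hG
  have hGg : ∀ x, G x = (g x : ℂ) := fun x => rfl
  have h1 := congrArg (fun T => T G) (Lp.fourier_toTemperedDistribution_eq (hf2.toLp f))
  simp only [TemperedDistribution.fourier_apply, Lp.toTemperedDistribution_apply] at h1
  have h2 : ∫ x, (𝓕 G) x • (hf2.toLp f) x = ∫ x, (𝓕 G) x • f x :=
    integral_congr_ae (by filter_upwards [hf2.coeFn_toLp] with x hx; rw [hx])
  have h3 := VectorFourier.integral_fourierIntegral_smul_eq_flip (L := innerₗ E) (μ := volume)
    (ν := volume) (f := G) (g := f) Real.continuous_fourierChar continuous_inner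
    G.integrable hf
  rw [flip_innerₗ] at h3
  have h4 : ∫ x, (𝓕 G) x • f x = ∫ x, G x • 𝓕 f x := h3
  have h5 := h1.symm.trans (h2.trans h4)
  simpa only [hGg, Complex.coe_smul] using h5

open FourierTransform in
theorem lintegral_enorm_fourier_sq {E : Type*} [NormedAddCommGroup E] [InnerProductSpace ℝ E]
    [FiniteDimensional ℝ E] [MeasurableSpace E] [BorelSpace E] {f : E → ℂ}
    (hf : Integrable f) (hf2 : MemLp f 2) :
    ∫⁻ ξ, ‖𝓕 f ξ‖ₑ ^ 2 = ∫⁻ x, ‖f x‖ₑ ^ 2 := by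
  have h := Lp.norm_fourier_eq (hf2.toLp f)
  rw [Lp.norm_def, Lp.norm_def, ENNReal.toReal_eq_toReal_iff' (Lp.eLpNorm_ne_top _)
    (Lp.eLpNorm_ne_top _), eLpNorm_congr_ae (fourier_toLp_ae_eq hf hf2),
    eLpNorm_congr_ae hf2.coeFn_toLp] at h
  have key : ∀ g : E → ℂ, ∫⁻ x, ‖g x‖ₑ ^ 2 = eLpNorm g 2 volume ^ 2 := fun g => by
    have := eLpNorm_nnreal_pow_eq_lintegral (f := g) (μ := (volume : Measure E)) (p := 2)
      two_ne_zero
    norm_num at this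
    exact this.symm
  rw [key, key, h]

/-- The unnormalised Fourier transform `∫ f(x) exp(-i x·ξ) dx` on `ℝ^ι`. -/
noncomputable def fourierPi {ι : Type*} [Fintype ι] (f : (ι → ℝ) → ℂ) (ξ : ι → ℝ) : ℂ :=
  ∫ x, f x * Complex.exp (-Complex.I * ((∑ i, x i * ξ i : ℝ) : ℂ))

open FourierTransform in
theorem fourierPi_eq {ι : Type*} [Fintype ι] (f : (ι → ℝ) → ℂ) (ξ : ι → ℝ) :
    fourierPi f ξ = 𝓕 (fun x : EuclideanSpace ℝ ι => f x.ofLp)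
      (WithLp.toLp 2 ((2 * Real.pi)⁻¹ • ξ)) := by
  rw [Real.fourier_eq', fourierPi, ← (PiLp.volume_preserving_ofLp ι).integral_comp
    (MeasurableEquiv.toLp 2 (ι → ℝ)).symm.measurableEmbedding]
  refine integral_congr_ae (Filter.Eventually.of_forall fun x => ?_)
  simp only [smul_eq_mul]
  rw [mul_comm]
  congr 2
  simp only [PiLp.inner_apply, RCLike.inner_apply, conj_trivial, Pi.smul_apply, smul_eq_mul]
  have : ∑ i, (2 * Real.pi)⁻¹ * ξ i * x.ofLp i = (2 * Real.pi)⁻¹ * ∑ i, x.ofLp i * ξ i := by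
    rw [Finset.mul_sum]; exact Finset.sum_congr rfl fun i _ => by ring
  rw [this]
  have hpi : (Real.pi : ℂ) ≠ 0 := by exact_mod_cast Real.pi_ne_zero
  push_cast
  field_simp

/-- The factor is the Jacobian of the dilation by 2π that relates `fourierPi` to the unitary
normalisation. -/
theorem lintegral_enorm_fourierPi_sq {ι : Type*} [Fintype ι] {f : (ι → ℝ) → ℂ}
    (hf : Integrable f) (hf2 : MemLp f 2) :
    ∫⁻ ξ, ‖fourierPi f ξ‖ₑ ^ 2 =
      ENNReal.ofReal ((2 * Real.pi) ^ Fintype.card ι) * ∫⁻ x, ‖f x‖ₑ ^ 2 := by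
  have hmp := PiLp.volume_preserving_ofLp ι
  have hemb := (MeasurableEquiv.toLp 2 (ι → ℝ)).symm.measurableEmbedding
  have hF := lintegral_enorm_fourier_sq (f := fun x : EuclideanSpace ℝ ι => f x.ofLp)
    (hmp.integrable_comp_of_integrable hf) (hf2.comp_measurePreserving hmp)
  rw [hmp.lintegral_comp_emb hemb (fun x => ‖f x‖ₑ ^ 2)] at hF
  rw [← hF, ← (PiLp.volume_preserving_toLp ι).lintegral_comp_emb
    (MeasurableEquiv.toLp 2 (ι → ℝ)).measurableEmbedding]
  simp only [fourierPi_eq]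
  set g : (ι → ℝ) → ENNReal := fun ξ => ‖FourierTransform.fourier
    (fun x : EuclideanSpace ℝ ι => f x.ofLp) (WithLp.toLp 2 ξ)‖ₑ ^ 2 with hg
  have hc : (2 * Real.pi)⁻¹ ≠ 0 := by positivity
  have hs : Measure.map (fun ξ : ι → ℝ => (2 * Real.pi)⁻¹ • ξ) volume =
      ENNReal.ofReal ((2 * Real.pi) ^ Fintype.card ι) • volume := by
    rw [Measure.map_addHaar_smul volume hc]
    congr 2
    rw [Module.finrank_fintype_fun_eq_card, inv_pow, inv_inv, abs_of_pos (by positivity)]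
  calc ∫⁻ ξ, g ((2 * Real.pi)⁻¹ • ξ)
      = ∫⁻ ξ, g ξ ∂(Measure.map (fun ξ : ι → ℝ => (2 * Real.pi)⁻¹ • ξ) volume) :=
        ((Homeomorph.smulOfNeZero _ hc).measurableEmbedding.lintegral_map g).symm
    _ = _ := by rw [hs, lintegral_smul_measure, smul_eq_mul]

end Plancherel

/-! ### The Hardy–Littlewood–Sobolev inequality on the line -/

section HardyLittlewoodSobolev

open scoped ENNReal

theorem lintegral_comp_abs_eq (g : ℝ → ℝ≥0∞) :
    ∫⁻ u, g |u| = 2 * ∫⁻ u in Set.Ioi (0 : ℝ), g u := by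
  have h1 : ∫⁻ u in Set.Ioi (0 : ℝ), g |u| = ∫⁻ u in Set.Ioi (0 : ℝ), g u :=
    setLIntegral_congr_fun measurableSet_Ioi fun u hu => by rw [abs_of_pos hu]
  have h2 : ∫⁻ u in Set.Iic (0 : ℝ), g |u| = ∫⁻ u in Set.Ioi (0 : ℝ), g |u| := by
    rw [setLIntegral_congr (Iio_ae_eq_Iic (a := (0 : ℝ))).symm]
    have := (Measure.measurePreserving_neg (volume : Measure ℝ)).setLIntegral_comp_preimage_emb
      (MeasurableEquiv.neg ℝ).measurableEmbedding (fun u => g |u|) (Set.Ioi 0)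
    simpa using this
  rw [← lintegral_add_compl (fun u => g |u|) (measurableSet_Ioi (a := (0 : ℝ))), Set.compl_Ioi, h2,
    h1, two_mul]

theorem setLIntegral_abs_rpow_lt {α r : ℝ} (hα : α < 1) (hr : 0 < r) :
    ∫⁻ u in {u : ℝ | |u| < r}, ENNReal.ofReal (|u| ^ (-α)) =
      ENNReal.ofReal (2 * r ^ (1 - α) / (1 - α)) := by
  have hm : MeasurableSet {u : ℝ | |u| < r} := measurableSet_lt (by fun_prop) measurable_const
  rw [← lintegral_indicator hm]
  have h := lintegral_comp_abs_eq ((Set.Iio r).indicator fun u => ENNReal.ofReal (u ^ (-α)))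
  rw [setLIntegral_indicator measurableSet_Iio, Set.inter_comm, Set.Ioi_inter_Iio,
    setLIntegral_congr Ioo_ae_eq_Ioc, ← ofReal_integral_eq_lintegral_ofReal] at h
  · refine Eq.trans ?_ (h.trans ?_)
    · rfl
    · rw [← intervalIntegral.integral_of_le hr.le, integral_rpow (Or.inl (by linarith)),
        Real.zero_rpow (by linarith), ← ENNReal.ofReal_ofNat, ← ENNReal.ofReal_mul (by norm_num)]
      congr 1
      rw [neg_add_eq_sub]; ring
  · exact (intervalIntegral.intervalIntegrable_rpow' (by linarith)).1
  · filter_upwards [self_mem_ae_restrict measurableSet_Ioc] with u hu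
    exact Real.rpow_nonneg hu.1.le _

theorem setLIntegral_abs_rpow_neg_two_ge {r : ℝ} (hr : 0 < r) :
    ∫⁻ u in {u : ℝ | r ≤ |u|}, ENNReal.ofReal (|u| ^ (-2 : ℝ)) = ENNReal.ofReal (2 / r) := by
  have hm : MeasurableSet {u : ℝ | r ≤ |u|} := measurableSet_le measurable_const (by fun_prop)
  rw [← lintegral_indicator hm]
  have h := lintegral_comp_abs_eq ((Set.Ici r).indicator fun u => ENNReal.ofReal (u ^ (-2 : ℝ)))
  rw [setLIntegral_indicator measurableSet_Ici,
    Set.inter_eq_left.2 (Set.Ici_subset_Ioi.2 hr),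
    setLIntegral_congr Ioi_ae_eq_Ici.symm, ← ofReal_integral_eq_lintegral_ofReal] at h
  · refine Eq.trans ?_ (h.trans ?_)
    · rfl
    · rw [integral_Ioi_rpow_of_lt (by norm_num) hr, ← ENNReal.ofReal_ofNat,
        ← ENNReal.ofReal_mul (by norm_num)]
      congr 1
      norm_num
      rw [Real.rpow_neg_one]; ring
  · exact integrableOn_Ioi_rpow_of_lt (by norm_num) hr
  · filter_upwards [self_mem_ae_restrict measurableSet_Ioi] with u hu
    exact Real.rpow_nonneg (hr.trans hu).le _

/-- The line is split at distance r = N/l^p from s. Near s, F ≤ l and the kernel is locally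
integrable because p < 2. Far from s, Hölder applies, and the kernel raised to the conjugate
exponent is |u|^{-2}. This r makes both contributions multiples of l^{p-1} N^{2/p-1}. -/
theorem lintegral_sublevel_mul_rpow_le {p : ℝ} (hp1 : 1 < p) (hp2 : p < 2) {F : ℝ → ℝ≥0∞}
    (hF : Measurable F) {N : ℝ} (hN : 0 < N) (hFN : ∫⁻ t, F t ^ p = ENNReal.ofReal N) (s : ℝ)
    {l : ℝ} (hl : 0 < l) :
    ∫⁻ t in {t | F t ≤ ENNReal.ofReal l}, F t * ENNReal.ofReal (|t - s| ^ (-(2 - 2 / p))) ≤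
      ENNReal.ofReal ((2 / (2 / p - 1) + 2 ^ (1 - 1 / p)) * l ^ (p - 1) * N ^ (2 / p - 1)) := by
  have hp0 : 0 < p := by linarith
  have hθ : 0 < 2 / p - 1 := by rw [sub_pos, lt_div_iff₀ hp0]; linarith
  set r : ℝ := N / l ^ p with hr
  have hlp : 0 < l ^ p := Real.rpow_pos_of_pos hl p
  have hr0 : 0 < r := div_pos hN hlp
  have hA : MeasurableSet {t | F t ≤ ENNReal.ofReal l} := measurableSet_le hF measurable_const
  have hB : MeasurableSet {t : ℝ | |t - s| < r} := measurableSet_lt (by fun_prop) measurable_const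
  have hK : Measurable fun t : ℝ => ENNReal.ofReal (|t - s| ^ (-(2 - 2 / p))) := by fun_prop
  have hshift : ∀ (g : ℝ → ℝ≥0∞) (S : Set ℝ), MeasurableSet S →
      ∫⁻ t in {t | t - s ∈ S}, g (t - s) = ∫⁻ u in S, g u := by
    intro g S hS
    exact (measurePreserving_sub_right volume s).setLIntegral_comp_preimage_emb
      (MeasurableEquiv.subRight s).measurableEmbedding g S
  have near : ∫⁻ t in {t | F t ≤ ENNReal.ofReal l} ∩ {t | |t - s| < r},
      F t * ENNReal.ofReal (|t - s| ^ (-(2 - 2 / p))) ≤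
      ENNReal.ofReal (2 / (2 / p - 1) * l ^ (p - 1) * N ^ (2 / p - 1)) := by
    calc _ ≤ ∫⁻ t in {t | F t ≤ ENNReal.ofReal l} ∩ {t | |t - s| < r},
          ENNReal.ofReal l * ENNReal.ofReal (|t - s| ^ (-(2 - 2 / p))) :=
          setLIntegral_mono' (hA.inter hB) fun t ht => mul_le_mul_left (α := ℝ≥0∞) ht.1 _
      _ ≤ ∫⁻ t in {t | t - s ∈ {u : ℝ | |u| < r}},
          ENNReal.ofReal l * ENNReal.ofReal (|t - s| ^ (-(2 - 2 / p))) :=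
          lintegral_mono_set Set.inter_subset_right
      _ = ENNReal.ofReal l * ENNReal.ofReal (2 * r ^ (2 / p - 1) / (2 / p - 1)) := by
          rw [lintegral_const_mul _ hK,
            hshift (fun u => ENNReal.ofReal (|u| ^ (-(2 - 2 / p)))) _
              (measurableSet_lt (by fun_prop) measurable_const),
            setLIntegral_abs_rpow_lt (by linarith) hr0]
          congr 3 <;> ring_nf
      _ = _ := by
          rw [← ENNReal.ofReal_mul hl.le, hr, Real.div_rpow hN.le hlp.le, ← Real.rpow_mul hl.le]
          congr 1
          have : l ^ (p - 1) = l / l ^ (p * (2 / p - 1)) := by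
            have h1 : p - 1 = 1 - p * (2 / p - 1) := by field_simp; ring
            rw [h1, Real.rpow_sub hl, Real.rpow_one]
          rw [this]; ring
  have far : ∫⁻ t in {t | F t ≤ ENNReal.ofReal l} ∩ {t | |t - s| < r}ᶜ,
      F t * ENNReal.ofReal (|t - s| ^ (-(2 - 2 / p))) ≤
      ENNReal.ofReal (2 ^ (1 - 1 / p) * l ^ (p - 1) * N ^ (2 / p - 1)) := by
    have hpq : p.HolderConjugate (p / (p - 1)) := .conjExponent hp1
    have hset : {t : ℝ | |t - s| < r}ᶜ = {t | t - s ∈ {u : ℝ | r ≤ |u|}} := by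
      ext t; simp
    calc _ ≤ ∫⁻ t in {t : ℝ | |t - s| < r}ᶜ, F t * ENNReal.ofReal (|t - s| ^ (-(2 - 2 / p))) :=
          lintegral_mono_set Set.inter_subset_right
      _ ≤ (∫⁻ t in {t : ℝ | |t - s| < r}ᶜ, F t ^ p) ^ (1 / p) *
          (∫⁻ t in {t : ℝ | |t - s| < r}ᶜ,
            ENNReal.ofReal (|t - s| ^ (-(2 - 2 / p))) ^ (p / (p - 1))) ^ (1 / (p / (p - 1))) :=
          ENNReal.lintegral_mul_le_Lp_mul_Lq _ hpq hF.aemeasurable hK.aemeasurable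
      _ ≤ ENNReal.ofReal N ^ (1 / p) * ENNReal.ofReal (2 / r) ^ (1 / (p / (p - 1))) := by
          have h1 : ∫⁻ t in {t : ℝ | |t - s| < r}ᶜ, F t ^ p ≤ ENNReal.ofReal N :=
            (setLIntegral_le_lintegral _ _).trans hFN.le
          have h2 : ∫⁻ t in {t : ℝ | |t - s| < r}ᶜ,
              ENNReal.ofReal (|t - s| ^ (-(2 - 2 / p))) ^ (p / (p - 1)) =
              ENNReal.ofReal (2 / r) := by
            rw [← setLIntegral_abs_rpow_neg_two_ge hr0, hset, ← hshift _ _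
              (measurableSet_le measurable_const (by fun_prop))]
            refine lintegral_congr fun t => ?_
            rw [ENNReal.ofReal_rpow_of_nonneg (Real.rpow_nonneg (abs_nonneg _) _)
              (div_nonneg hp0.le (by linarith)), ← Real.rpow_mul (abs_nonneg _)]
            congr 2
            have : p - 1 ≠ 0 := by linarith
            field_simp
          rw [h2]
          gcongr
      _ = _ := by
          rw [ENNReal.ofReal_rpow_of_nonneg hN.le (by positivity),
            ENNReal.ofReal_rpow_of_nonneg (by positivity)
              (one_div_nonneg.2 (div_nonneg hp0.le (by linarith))),
            ← ENNReal.ofReal_mul (by positivity)]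
          congr 1
          have h1 : 1 / (p / (p - 1)) = 1 - 1 / p := by
            have : p - 1 ≠ 0 := by linarith
            field_simp
          have h2 : 2 / r = 2 * l ^ p / N := by rw [hr]; field_simp
          rw [h1, h2, Real.div_rpow (by positivity) hN.le, Real.mul_rpow (by norm_num) hlp.le,
            ← Real.rpow_mul hl.le]
          have h3 : N ^ (2 / p - 1) = N ^ (1 / p) / N ^ (1 - 1 / p) := by
            rw [← Real.rpow_sub hN]; congr 1; ring
          have h4 : p * (1 - 1 / p) = p - 1 := by field_simp
          rw [h3, h4]; ring
  rw [← lintegral_inter_add_sdiff _ _ hB]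
  refine (add_le_add near far).trans (le_of_eq ?_)
  rw [← ENNReal.ofReal_add (by positivity) (by positivity)]
  congr 1; ring

/-- The diagonal **Hardy–Littlewood–Sobolev inequality** on the line. -/
theorem hardy_littlewood_sobolev_diagonal {p : ℝ} (hp1 : 1 < p) (hp2 : p < 2) :
    ∃ C : ℝ≥0∞, C ≠ ∞ ∧ ∀ F : ℝ → ℝ≥0∞, Measurable F → (∀ t, F t ≠ ∞) → ∫⁻ t, F t ^ p ≠ ∞ →
      ∫⁻ s, ∫⁻ t, F s * F t * ENNReal.ofReal (|t - s| ^ (-(2 - 2 / p))) ≤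
        C * (∫⁻ t, F t ^ p) ^ (2 / p) := by
  have hp0 : 0 < p := by linarith
  have hθ : 0 < 2 / p - 1 := by rw [sub_pos, lt_div_iff₀ hp0]; linarith
  set C₀ : ℝ := 2 / (2 / p - 1) + 2 ^ (1 - 1 / p) with hC₀
  have hC₀0 : 0 ≤ C₀ := by positivity
  refine ⟨2 * ENNReal.ofReal C₀, ENNReal.mul_ne_top (by norm_num) ENNReal.ofReal_ne_top,
    fun F hF hFt hFp => ?_⟩
  obtain ⟨N, hN0, hN⟩ : ∃ N : ℝ, 0 ≤ N ∧ ∫⁻ t, F t ^ p = ENNReal.ofReal N :=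
    ⟨_, ENNReal.toReal_nonneg, (ENNReal.ofReal_toReal hFp).symm⟩
  -- The splitting radius must be positive. If `N = 0`, then `F` vanishes almost everywhere.
  rcases hN0.eq_or_lt with h0 | hNpos
  · rw [← h0, ENNReal.ofReal_zero] at hN
    have hae := ENNReal.ae_eq_zero_of_lintegral_rpow_eq_zero hp0.le hF.aemeasurable hN
    refine le_of_eq_of_le ?_ zero_le
    rw [lintegral_eq_zero_iff' (by fun_prop)]
    filter_upwards [hae] with s hs
    simp [hs]
  set K : ℝ → ℝ → ℝ≥0∞ := fun s t => ENNReal.ofReal (|t - s| ^ (-(2 - 2 / p))) with hK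
  have hKm : Measurable (Function.uncurry K) := by
    simp only [hK, Function.uncurry_def]; fun_prop
  have hKs : ∀ s t, K s t = K t s := fun s t => by simp only [hK]; rw [abs_sub_comm]
  -- By symmetry of the kernel, only pairs with F(t) ≤ F(s) matter, at the cost of a factor 2. On
  -- these the sublevel bound with l = F(s) leaves F(s)^p N^{2/p-1}, whose integral in s is N^{2/p}.
  set G : ℝ → ℝ → ℝ≥0∞ := fun s t => {t | F t ≤ F s}.indicator (fun t => F s * F t * K s t) t
    with hG
  have hGm : Measurable (Function.uncurry G) := by
    have hS : MeasurableSet {q : ℝ × ℝ | F q.2 ≤ F q.1} :=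
      measurableSet_le (by fun_prop) (by fun_prop)
    have : Function.uncurry G = {q : ℝ × ℝ | F q.2 ≤ F q.1}.indicator
        (fun q => F q.1 * F q.2 * Function.uncurry K q) := by
      ext ⟨s, t⟩
      simp [hG, Set.indicator, Function.uncurry]
    rw [this]
    exact Measurable.indicator (by fun_prop) hS
  have hGle : ∀ s t, F s * F t * K s t ≤ G s t + G t s := by
    intro s t
    rcases le_total (F t) (F s) with h | h
    · refine le_add_right ?_
      simp [hG, Set.indicator, h]
    · refine le_add_left ?_
      simp only [hG, Set.indicator, Set.mem_ofPred_eq, h, if_true]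
      rw [hKs s t, mul_comm (F s)]
  have hinner : ∀ s, ∫⁻ t, G s t ≤ F s ^ p * ENNReal.ofReal (C₀ * N ^ (2 / p - 1)) := by
    intro s
    have hS : MeasurableSet {t | F t ≤ F s} := measurableSet_le hF measurable_const
    rcases eq_or_ne (F s) 0 with h | h
    · have : ∀ t, G s t = 0 := fun t => by simp [hG, h]
      simp [this]
    have hl : 0 < (F s).toReal := ENNReal.toReal_pos h (hFt s)
    have hls : F s = ENNReal.ofReal (F s).toReal := (ENNReal.ofReal_toReal (hFt s)).symm
    have := lintegral_sublevel_mul_rpow_le hp1 hp2 hF hNpos hN s hl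
    rw [← hls] at this
    simp only [hG]
    rw [lintegral_indicator hS]
    simp only [mul_assoc (F s)]
    rw [lintegral_const_mul _ (by fun_prop)]
    refine (mul_le_mul_right this _).trans (le_of_eq ?_)
    rw [hls, ← ENNReal.ofReal_mul hl.le, ENNReal.ofReal_rpow_of_pos hl,
      ← ENNReal.ofReal_mul (by positivity), ENNReal.toReal_ofReal hl.le]
    congr 1
    have : (F s).toReal ^ p = (F s).toReal * (F s).toReal ^ (p - 1) := by
      rw [← Real.rpow_one_add' hl.le (by linarith)]; congr 1; ring
    rw [this]; ring
  calc ∫⁻ s, ∫⁻ t, F s * F t * K s t ≤ ∫⁻ s, ∫⁻ t, (G s t + G t s) :=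
        lintegral_mono fun s => lintegral_mono fun t => hGle s t
    _ = (∫⁻ s, ∫⁻ t, G s t) + ∫⁻ s, ∫⁻ t, G t s := by
        rw [← lintegral_add_left (Measurable.lintegral_prod_right hGm)]
        exact lintegral_congr fun s => lintegral_add_left (hGm.of_uncurry_left) _
    _ = 2 * ∫⁻ s, ∫⁻ t, G s t := by
        rw [two_mul, lintegral_lintegral_swap (f := fun s t => G t s)]
        exact (hGm.comp measurable_swap).aemeasurable
    _ ≤ 2 * ∫⁻ s, F s ^ p * ENNReal.ofReal (C₀ * N ^ (2 / p - 1)) := by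
        gcongr with s; exact hinner s
    _ = _ := by
        rw [lintegral_mul_const _ (by fun_prop), hN, mul_assoc,
          ENNReal.ofReal_rpow_of_pos hNpos, ← ENNReal.ofReal_mul hN0, ← ENNReal.ofReal_mul hC₀0]
        congr 2
        have : N ^ (2 / p) = N * N ^ (2 / p - 1) := by
          rw [← Real.rpow_one_add' hN0 (by linarith)]; congr 1; ring
        rw [this]; ring

end HardyLittlewoodSobolev

/-! ### Step functions over disjoint sets -/

section StepFunctions

open scoped ENNReal

/-- The step function `∑ i, c i • 1_{E i}`. -/
noncomputable def stepFun {ι X : Type*} [Fintype ι] (c : ι → ℂ) (E : ι → Set X) (x : X) : ℂ :=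
  ∑ i, (E i).indicator (fun _ => c i) x

variable {ι X : Type*} [Fintype ι] {E : ι → Set X}

/-- By disjointness at most one term is nonzero at each point. This is what makes norms and their
powers additive over the pieces. -/
theorem comp_stepFun {M : Type*} [AddCommMonoid M] (hE : Pairwise (Function.onFun Disjoint E))
    (c : ι → ℂ) {φ : ℂ → M} (hφ : φ 0 = 0) (x : X) :
    φ (stepFun c E x) = ∑ i, (E i).indicator (fun _ => φ (c i)) x := by
  classical
  by_cases h : ∃ i, x ∈ E i
  · obtain ⟨i, hi⟩ := h
    have hne : ∀ j, j ≠ i → x ∉ E j := fun j hj hx => Set.disjoint_left.1 (hE hj) hx hi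
    rw [stepFun, Finset.sum_eq_single i (fun j _ hj => Set.indicator_of_notMem (hne j hj) _)
      (by simp), Finset.sum_eq_single i (fun j _ hj => Set.indicator_of_notMem (hne j hj) _)
      (by simp), Set.indicator_of_mem hi, Set.indicator_of_mem hi]
  · push Not at h
    rw [stepFun, Finset.sum_eq_zero (fun j _ => Set.indicator_of_notMem (h j) _),
      Finset.sum_eq_zero (fun j _ => Set.indicator_of_notMem (h j) _), hφ]

variable [MeasurableSpace X]

theorem measurable_stepFun (hE : ∀ i, MeasurableSet (E i)) (c : ι → ℂ) :
    Measurable (stepFun c E) :=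
  Finset.measurable_fun_sum _ fun i _ => measurable_const.indicator (hE i)

theorem integrable_stepFun {μ : Measure X} (hE : ∀ i, MeasurableSet (E i)) (hμ : ∀ i, μ (E i) ≠ ∞)
    (c : ι → ℂ) : Integrable (stepFun c E) μ :=
  integrable_finsetSum _ fun i _ =>
    (integrable_indicator_iff (hE i)).2 (integrableOn_const (hμ i))

theorem memLp_stepFun {μ : Measure X} (hE : ∀ i, MeasurableSet (E i)) (hμ : ∀ i, μ (E i) ≠ ∞)
    (c : ι → ℂ) (p : ℝ≥0∞) : MemLp (stepFun c E) p μ :=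
  memLp_finsetSum _ fun i _ => memLp_indicator_const p (hE i) (c i) (Or.inr (hμ i))

theorem lintegral_enorm_stepFun_rpow {μ : Measure X} (hd : Pairwise (Function.onFun Disjoint E))
    (hE : ∀ i, MeasurableSet (E i)) (hμ : ∀ i, μ (E i) ≠ ∞) (c : ι → ℂ) {q : ℝ} (hq : 0 < q) :
    ∫⁻ x, ‖stepFun c E x‖ₑ ^ q ∂μ = ENNReal.ofReal (∑ i, ‖c i‖ ^ q * μ.real (E i)) := by
  have h := comp_stepFun hd c (φ := fun z => ‖z‖ₑ ^ q) (by simp [hq])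
  simp only [h]
  rw [lintegral_finsetSum _ fun i _ => measurable_const.indicator (hE i),
    ENNReal.ofReal_sum_of_nonneg fun i _ => by positivity]
  refine Finset.sum_congr rfl fun i _ => ?_
  rw [lintegral_indicator_const (hE i), ENNReal.ofReal_mul (by positivity),
    ofReal_measureReal (hμ i), ← ENNReal.ofReal_rpow_of_nonneg (norm_nonneg _) hq.le,
    ofReal_norm]

theorem integral_norm_stepFun {μ : Measure X} (hd : Pairwise (Function.onFun Disjoint E))
    (hE : ∀ i, MeasurableSet (E i)) (hμ : ∀ i, μ (E i) ≠ ∞) (c : ι → ℂ) :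
    ∫ x, ‖stepFun c E x‖ ∂μ = ∑ i, ‖c i‖ * μ.real (E i) := by
  have h := comp_stepFun hd c (φ := fun z => ‖z‖) (by simp)
  simp only [h]
  rw [integral_finsetSum _ fun i _ =>
    (integrable_indicator_iff (hE i)).2 (integrableOn_const (hμ i))]
  refine Finset.sum_congr rfl fun i _ => ?_
  rw [integral_indicator_const _ (hE i), smul_eq_mul, mul_comm]

theorem fourierPi_stepFun {σ : Type*} [Fintype σ] {E : ι → Set (σ → ℝ)}
    (hE : ∀ i, MeasurableSet (E i)) (hμ : ∀ i, volume (E i) ≠ ∞) (c : ι → ℂ) (ξ : σ → ℝ) :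
    fourierPi (stepFun c E) ξ = ∑ i, c i * fourierPi ((E i).indicator fun _ => 1) ξ := by
  have hexp : Continuous fun x : σ → ℝ => Complex.exp (-Complex.I * ((∑ i, x i * ξ i : ℝ) : ℂ)) :=
    by fun_prop
  have hn : ∀ x : σ → ℝ, ‖Complex.exp (-Complex.I * ((∑ i, x i * ξ i : ℝ) : ℂ))‖ ≤ 1 := fun x => by
    rw [neg_mul, ← mul_neg, mul_comm, ← Complex.ofReal_neg, Complex.norm_exp_ofReal_mul_I]
  simp only [fourierPi, stepFun, Finset.sum_mul]
  rw [integral_finsetSum]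
  · refine Finset.sum_congr rfl fun i _ => ?_
    rw [← integral_const_mul]
    refine integral_congr_ae (Filter.Eventually.of_forall fun x => ?_)
    by_cases hx : x ∈ E i <;> simp [hx]
  · intro i _
    exact ((integrable_indicator_iff (hE i)).2 (integrableOn_const (hμ i))).mul_bdd
      hexp.aestronglyMeasurable (Filter.Eventually.of_forall hn)

end StepFunctions

/-! ### Fixed-time dispersive estimates -/

section DispersiveForm

open scoped ENNReal ComplexConjugate

theorem norm_cexp_neg_I_mul (r : ℝ) : ‖Complex.exp (-Complex.I * (r : ℂ))‖ = 1 := by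
  rw [neg_mul, ← mul_neg, mul_comm, ← Complex.ofReal_neg, Complex.norm_exp_ofReal_mul_I]

variable {σ : Type*} [Fintype σ]

theorem norm_fourierPi_le (f : (σ → ℝ) → ℂ) (ξ : σ → ℝ) : ‖fourierPi f ξ‖ ≤ ∫ x, ‖f x‖ := by
  refine (norm_integral_le_integral_norm _).trans (le_of_eq ?_)
  simp only [norm_mul, norm_cexp_neg_I_mul, mul_one]

theorem continuous_fourierPi {f : (σ → ℝ) → ℂ} (hf : Integrable f) : Continuous (fourierPi f) := by
  refine continuous_of_dominated (bound := fun x => ‖f x‖) (fun ξ => ?_) (fun ξ => ?_) hf.norm ?_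
  · exact hf.aestronglyMeasurable.mul (Continuous.aestronglyMeasurable (by fun_prop))
  · refine Filter.Eventually.of_forall fun x => ?_
    rw [norm_mul, norm_cexp_neg_I_mul, mul_one]
  · exact Filter.Eventually.of_forall fun x => by fun_prop

/-- The cube `[-N, N]^σ`. -/
def cube (σ : Type*) (N : ℝ) : Set (σ → ℝ) := Set.univ.pi fun _ => Set.Icc (-N) N

theorem measurableSet_cube (N : ℝ) : MeasurableSet (cube σ N) :=
  MeasurableSet.univ_pi fun _ => measurableSet_Icc

instance isFiniteMeasure_restrict_cube (N : ℝ) :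
    IsFiniteMeasure ((volume : Measure (σ → ℝ)).restrict (cube σ N)) :=
  ⟨by rw [Measure.restrict_apply_univ]
      exact (isCompact_univ_pi fun _ => isCompact_Icc).measure_lt_top⟩

/-- The polynomial `∑ j, a j * ξ j ^ k j`. -/
def diagPoly (a : σ → ℝ) (k : σ → ℕ) (ξ : σ → ℝ) : ℝ := ∑ j, a j * ξ j ^ k j

theorem continuous_diagPoly (a : σ → ℝ) (k : σ → ℕ) : Continuous (diagPoly a k) := by
  unfold diagPoly; fun_prop

/-- The form `∫ e^{-iτR(ξ)} f̂(ξ) conj (ĝ(ξ)) dξ`, truncated to the cube `[-N, N]^σ`. -/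
noncomputable def dispForm (a : σ → ℝ) (k : σ → ℕ) (N τ : ℝ) (f g : (σ → ℝ) → ℂ) : ℂ :=
  ∫ ξ in cube σ N, Complex.exp (-Complex.I * ((τ * diagPoly a k ξ : ℝ) : ℂ)) *
    (fourierPi f ξ * conj (fourierPi g ξ))

/-- The phase is a sum of functions of single coordinates, so the integral over the cube is a
product of van der Corput integrals with α = -τ a_j and β = -z_j. Neither N nor z enters the bound.
-/
theorem norm_setIntegral_cube_le {a : σ → ℝ} (ha : ∀ j, a j ≠ 0) {k : σ → ℕ} (hk : ∀ j, 2 ≤ k j)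
    {N τ : ℝ} (hN : 0 ≤ N) (hτ : τ ≠ 0) (z : σ → ℝ) :
    ‖∫ ξ in cube σ N, Complex.exp (-Complex.I * ((τ * diagPoly a k ξ + ∑ j, z j * ξ j : ℝ) : ℂ))‖ ≤
      (∏ j, 18 * |a j| ^ (-(1 / k j : ℝ))) * |τ| ^ (-∑ j, (1 / k j : ℝ)) := by
  have h1 : ∀ ξ : σ → ℝ,
      Complex.exp (-Complex.I * ((τ * diagPoly a k ξ + ∑ j, z j * ξ j : ℝ) : ℂ)) =
      ∏ j, Complex.exp (Complex.I * (((-τ * a j) * ξ j ^ k j + (-z j) * ξ j : ℝ) : ℂ)) := by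
    intro ξ
    rw [← Complex.exp_sum, ← Finset.mul_sum, neg_mul, ← mul_neg, ← Complex.ofReal_sum,
      ← Complex.ofReal_neg, diagPoly, Finset.mul_sum, ← Finset.sum_add_distrib,
      ← Finset.sum_neg_distrib]
    congr 3
    exact Finset.sum_congr rfl fun j _ => by ring
  simp only [h1]
  rw [cube, volume_pi, Measure.restrict_pi_pi, integral_fintype_prod_eq_prod (fun j (x : ℝ) =>
      Complex.exp (Complex.I * (((-τ * a j) * x ^ k j + (-z j) * x : ℝ) : ℂ))), norm_prod]
  have h2 : (∏ j, 18 * |a j| ^ (-(1 / k j : ℝ))) * |τ| ^ (-∑ j, (1 / k j : ℝ)) =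
      ∏ j, 18 * |-τ * a j| ^ (-(1 / k j : ℝ)) := by
    rw [← Finset.sum_neg_distrib, Real.rpow_sum_of_pos (abs_pos.2 hτ), ← Finset.prod_mul_distrib]
    refine Finset.prod_congr rfl fun j _ => ?_
    rw [abs_mul, abs_neg, Real.mul_rpow (abs_nonneg _) (abs_nonneg _)]
    ring
  rw [h2]
  refine Finset.prod_le_prod (fun j _ => norm_nonneg _) fun j _ => ?_
  rw [integral_Icc_eq_integral_Ioc, ← intervalIntegral.integral_of_le (by linarith)]
  exact norm_integral_cexp_pow_le (hk j) (mul_ne_zero (neg_ne_zero.2 hτ) (ha j)) (-z j) hN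

/-- The dispersive `L¹ × L¹` bound. -/
theorem norm_dispForm_le_L1 {a : σ → ℝ} (ha : ∀ j, a j ≠ 0) {k : σ → ℕ} (hk : ∀ j, 2 ≤ k j)
    {N τ : ℝ} (hN : 0 ≤ N) (hτ : τ ≠ 0) {f g : (σ → ℝ) → ℂ} (hf : Integrable f)
    (hg : Integrable g) :
    ‖dispForm a k N τ f g‖ ≤ (∏ j, 18 * |a j| ^ (-(1 / k j : ℝ))) *
      |τ| ^ (-∑ j, (1 / k j : ℝ)) * ((∫ x, ‖f x‖) * ∫ x, ‖g x‖) := by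
  have hR := continuous_diagPoly a k
  set A := (∏ j, 18 * |a j| ^ (-(1 / k j : ℝ))) * |τ| ^ (-∑ j, (1 / k j : ℝ)) with hA
  have hg' : Integrable (fun y => conj (g y)) :=
    Complex.conjLIE.integrable_comp_iff.2 hg
  have hfg := hf.mul_prod hg'
  -- Both transforms are expanded, so that ξ can be integrated first. The inner integral is then the
  -- truncated kernel at x - y. Fubini applies because the cube has finite measure.
  set H : (σ → ℝ) → (σ → ℝ) × (σ → ℝ) → ℂ := fun ξ z => f z.1 * conj (g z.2) *
    Complex.exp (-Complex.I * ((τ * diagPoly a k ξ + ∑ j, (z.1 j - z.2 j) * ξ j : ℝ) : ℂ)) with hH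
  have h1 : ∀ ξ, Complex.exp (-Complex.I * ((τ * diagPoly a k ξ : ℝ) : ℂ)) *
      (fourierPi f ξ * conj (fourierPi g ξ)) = ∫ z, H ξ z := by
    intro ξ
    have : conj (fourierPi g ξ) =
        ∫ y, conj (g y) * Complex.exp (Complex.I * ((∑ i, y i * ξ i : ℝ) : ℂ)) := by
      rw [fourierPi, ← integral_conj]
      refine integral_congr_ae (Filter.Eventually.of_forall fun y => ?_)
      simp only [map_mul, ← Complex.exp_conj, map_neg, Complex.conj_I, Complex.conj_ofReal, neg_neg]
    rw [this, fourierPi, ← integral_prod_mul, ← integral_const_mul]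
    refine integral_congr_ae (Filter.Eventually.of_forall fun z => ?_)
    simp only [hH]
    have hs : ∑ j, (z.1 j - z.2 j) * ξ j = ∑ j, z.1 j * ξ j - ∑ j, z.2 j * ξ j := by
      rw [← Finset.sum_sub_distrib]; exact Finset.sum_congr rfl fun j _ => by ring
    have he : Complex.exp (-Complex.I * ((τ * diagPoly a k ξ + ∑ j, (z.1 j - z.2 j) * ξ j : ℝ) : ℂ))
        = Complex.exp (-Complex.I * ((τ * diagPoly a k ξ : ℝ) : ℂ)) *
          Complex.exp (-Complex.I * ((∑ j, z.1 j * ξ j : ℝ) : ℂ)) *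
          Complex.exp (Complex.I * ((∑ j, z.2 j * ξ j : ℝ) : ℂ)) := by
      rw [← Complex.exp_add, ← Complex.exp_add, hs]
      congr 1
      push_cast
      ring
    rw [he]; ring
  have hHint : Integrable (Function.uncurry H)
      ((volume.restrict (cube σ N)).prod (volume.prod volume)) := by
    have hc := hfg.comp_snd (volume.restrict (cube σ N))
    exact hc.mul_bdd (c := 1) (Continuous.aestronglyMeasurable (by fun_prop))
      (Filter.Eventually.of_forall fun q => (norm_cexp_neg_I_mul _).le)
  rw [dispForm]
  simp only [h1]
  rw [Measure.volume_eq_prod, integral_integral_swap hHint]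
  refine (norm_integral_le_integral_norm _).trans ?_
  calc ∫ z, ‖∫ ξ in cube σ N, H ξ z‖ ∂(volume.prod volume)
      ≤ ∫ z : (σ → ℝ) × (σ → ℝ), A * (‖f z.1‖ * ‖g z.2‖) ∂(volume.prod volume) := by
        refine integral_mono_of_nonneg (Filter.Eventually.of_forall fun z => norm_nonneg _)
          ((hf.norm.mul_prod hg.norm).const_mul A) (Filter.Eventually.of_forall fun z => ?_)
        simp only [hH]
        rw [integral_const_mul, norm_mul, norm_mul, RCLike.norm_conj, mul_comm]
        exact mul_le_mul_of_nonneg_right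
          (norm_setIntegral_cube_le ha hk hN hτ fun j => z.1 j - z.2 j) (by positivity)
    _ = _ := by rw [integral_const_mul, integral_prod_mul (fun x => ‖f x‖) (fun x => ‖g x‖)]

/-- The `L² × L²` bound, from Plancherel's identity. -/
theorem enorm_dispForm_le_L2 (a : σ → ℝ) (k : σ → ℕ) (N τ : ℝ) {f g : (σ → ℝ) → ℂ}
    (hf : Integrable f) (hf2 : MemLp f 2) (hg : Integrable g) (hg2 : MemLp g 2) :
    ‖dispForm a k N τ f g‖ₑ ≤ ENNReal.ofReal ((2 * Real.pi) ^ Fintype.card σ) *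
      ((∫⁻ x, ‖f x‖ₑ ^ (2 : ℝ)) * ∫⁻ x, ‖g x‖ₑ ^ (2 : ℝ)) ^ (1 / 2 : ℝ) := by
  have hFm := (continuous_fourierPi hf).enorm.measurable
  have hGm := (continuous_fourierPi hg).enorm.measurable
  calc ‖dispForm a k N τ f g‖ₑ
      ≤ ∫⁻ ξ in cube σ N, ‖fourierPi f ξ‖ₑ * ‖fourierPi g ξ‖ₑ := by
        refine (enorm_integral_le_lintegral_enorm _).trans (le_of_eq (lintegral_congr fun ξ => ?_))
        have : ∀ r : ℝ, ‖Complex.exp (-Complex.I * (r : ℂ))‖ₑ = 1 := fun r => by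
          rw [← ofReal_norm, norm_cexp_neg_I_mul, ENNReal.ofReal_one]
        rw [enorm_mul, enorm_mul, this, one_mul, RCLike.enorm_conj]
    _ ≤ ∫⁻ ξ, ‖fourierPi f ξ‖ₑ * ‖fourierPi g ξ‖ₑ := setLIntegral_le_lintegral _ _
    _ ≤ (∫⁻ ξ, ‖fourierPi f ξ‖ₑ ^ (2 : ℝ)) ^ (1 / 2 : ℝ) *
          (∫⁻ ξ, ‖fourierPi g ξ‖ₑ ^ (2 : ℝ)) ^ (1 / 2 : ℝ) :=
        ENNReal.lintegral_mul_le_Lp_mul_Lq _ Real.HolderConjugate.two_two hFm.aemeasurable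
          hGm.aemeasurable
    _ = _ := by
        simp only [ENNReal.rpow_ofNat]
        rw [lintegral_enorm_fourierPi_sq hf hf2, lintegral_enorm_fourierPi_sq hg hg2,
          ← ENNReal.mul_rpow_of_nonneg _ _ (by norm_num : (0 : ℝ) ≤ 1 / 2), mul_mul_mul_comm,
          ENNReal.mul_rpow_of_nonneg _ _ (by norm_num : (0 : ℝ) ≤ 1 / 2), ← sq, ← ENNReal.rpow_natCast,
          ← ENNReal.rpow_mul]
        norm_num

/-- This reduces the form to a finite matrix, the shape required for `riesz_thorin_bilinear`. -/
theorem dispForm_stepFun (a : σ → ℝ) (k : σ → ℕ) (N τ : ℝ) {ι κ : Type*} [Fintype ι] [Fintype κ]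
    {E : ι → Set (σ → ℝ)} (hE : ∀ i, MeasurableSet (E i)) (hμ : ∀ i, volume (E i) ≠ ∞)
    {F : κ → Set (σ → ℝ)} (hF : ∀ i, MeasurableSet (F i)) (hν : ∀ i, volume (F i) ≠ ∞)
    (c : ι → ℂ) (d : κ → ℂ) :
    dispForm a k N τ (stepFun c E) (stepFun d F) = ∑ i, ∑ j, c i * conj (d j) *
      dispForm a k N τ ((E i).indicator fun _ => 1) ((F j).indicator fun _ => 1) := by
  have hR := continuous_diagPoly a k
  have hcE : ∀ i, Continuous (fourierPi ((E i).indicator fun _ => 1)) := fun i =>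
    continuous_fourierPi ((integrable_indicator_iff (hE i)).2 (integrableOn_const (hμ i)))
  have hcF : ∀ i, Continuous (fourierPi ((F i).indicator fun _ => 1)) := fun i =>
    continuous_fourierPi ((integrable_indicator_iff (hF i)).2 (integrableOn_const (hν i)))
  have hint : ∀ i j, Integrable (fun ξ => Complex.exp (-Complex.I * ((τ * diagPoly a k ξ : ℝ) : ℂ)) *
      (fourierPi ((E i).indicator fun _ => 1) ξ * conj (fourierPi ((F j).indicator fun _ => 1) ξ)))
      (volume.restrict (cube σ N)) := fun i j => by
    refine ContinuousOn.integrableOn_compact (isCompact_univ_pi fun _ => isCompact_Icc)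
      (Continuous.continuousOn ?_)
    have := hcE i
    have := hcF j
    fun_prop
  have h1 : ∀ ξ, Complex.exp (-Complex.I * ((τ * diagPoly a k ξ : ℝ) : ℂ)) *
      (fourierPi (stepFun c E) ξ * conj (fourierPi (stepFun d F) ξ)) =
      ∑ i, ∑ j, c i * conj (d j) * (Complex.exp (-Complex.I * ((τ * diagPoly a k ξ : ℝ) : ℂ)) *
        (fourierPi ((E i).indicator fun _ => 1) ξ *
          conj (fourierPi ((F j).indicator fun _ => 1) ξ))) := by
    intro ξ
    rw [fourierPi_stepFun hE hμ, fourierPi_stepFun hF hν, map_sum, Finset.sum_mul_sum,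
      Finset.mul_sum]
    refine Finset.sum_congr rfl fun i _ => ?_
    rw [Finset.mul_sum]
    refine Finset.sum_congr rfl fun j _ => ?_
    rw [map_mul]; ring
  simp only [dispForm, h1]
  rw [integral_finsetSum _ fun i _ => integrable_finsetSum _ fun j _ => (hint i j).const_mul _]
  refine Finset.sum_congr rfl fun i _ => ?_
  rw [integral_finsetSum _ fun j _ => (hint i j).const_mul _]
  exact Finset.sum_congr rfl fun j _ => integral_const_mul _ _

/-- The fixed-time `Lᵖ × Lᵖ` bound on step functions, by interpolation. -/
theorem exists_norm_dispForm_stepFun_le {a : σ → ℝ} (ha : ∀ j, a j ≠ 0) {k : σ → ℕ}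
    (hk : ∀ j, 2 ≤ k j) {p : ℝ} (hp1 : 1 < p) (hp2 : p < 2)
    (hpk : (∑ j, (1 / k j : ℝ)) * (2 / p - 1) = 2 - 2 / p) :
    ∃ C : ℝ, 0 ≤ C ∧ ∀ {N τ : ℝ}, 0 ≤ N → τ ≠ 0 → ∀ {ι κ : Type} [Fintype ι] [Fintype κ]
      {E : ι → Set (σ → ℝ)}, Pairwise (Function.onFun Disjoint E) → (∀ i, MeasurableSet (E i)) →
      (∀ i, volume (E i) ≠ ∞) → ∀ {F : κ → Set (σ → ℝ)}, Pairwise (Function.onFun Disjoint F) →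
      (∀ i, MeasurableSet (F i)) → (∀ i, volume (F i) ≠ ∞) → ∀ (c : ι → ℂ) (d : κ → ℂ),
      ‖dispForm a k N τ (stepFun c E) (stepFun d F)‖ ≤ C * |τ| ^ (-(2 - 2 / p)) *
        ((∑ i, ‖c i‖ ^ p * volume.real (E i)) * ∑ j, ‖d j‖ ^ p * volume.real (F j)) ^ (1 / p) := by
  set D : ℝ := ∏ j, 18 * |a j| ^ (-(1 / k j : ℝ)) with hD
  have hD0 : 0 ≤ D := Finset.prod_nonneg fun j _ => by positivity
  set A : ℝ := (2 * Real.pi) ^ Fintype.card σ with hA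
  have hA0 : 0 ≤ A := by positivity
  refine ⟨A ^ (2 - 2 / p) * D ^ (2 / p - 1), by positivity, ?_⟩
  intro N τ hN hτ ι κ _ _ E hEd hE hμ F hFd hF hν c d
  -- The form is conjugate-linear in its second argument. Conjugating `d` makes it bilinear and
  -- leaves all norms unchanged.
  have hsum : ∀ (c : ι → ℂ) (d : κ → ℂ), ∑ i, ∑ j, c i * d j *
      dispForm a k N τ ((E i).indicator fun _ => 1) ((F j).indicator fun _ => 1) =
      dispForm a k N τ (stepFun c E) (stepFun (fun j => conj (d j)) F) := fun c d => by
    rw [dispForm_stepFun a k N τ hE hμ hF hν]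
    simp only [Complex.conj_conj]
  have key := riesz_thorin_bilinear
    (fun i j => dispForm a k N τ ((E i).indicator fun _ => 1) ((F j).indicator fun _ => 1))
    (μ := fun i => volume.real (E i)) (ν := fun j => volume.real (F j))
    (fun _ => measureReal_nonneg) (fun _ => measureReal_nonneg)
    (A₁ := D * |τ| ^ (-∑ j, (1 / k j : ℝ))) (A₂ := A) (by positivity) hA0 ?_ ?_ hp1 hp2
    c (fun j => conj (d j))
  · rw [hsum] at key
    simp only [Complex.conj_conj, RCLike.norm_conj] at key
    refine key.trans (le_of_eq ?_)
    -- Here `hpk` identifies the interpolated decay in τ with the Hardy–Littlewood–Sobolev exponent.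
    rw [Real.mul_rpow hD0 (by positivity), ← Real.rpow_mul (abs_nonneg _), neg_mul, hpk]
    ring
  · intro c d
    rw [hsum]
    have := norm_dispForm_le_L1 ha hk hN hτ (integrable_stepFun hE hμ c)
      (integrable_stepFun hF hν fun j => conj (d j))
    simpa only [integral_norm_stepFun hEd hE hμ, integral_norm_stepFun hFd hF hν,
      RCLike.norm_conj] using this
  · intro c d
    rw [hsum]
    have := enorm_dispForm_le_L2 a k N τ (integrable_stepFun hE hμ c) (memLp_stepFun hE hμ c 2)
      (integrable_stepFun hF hν fun j => conj (d j)) (memLp_stepFun hF hν _ 2)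
    rw [lintegral_enorm_stepFun_rpow hEd hE hμ c (by norm_num),
      lintegral_enorm_stepFun_rpow hFd hF hν _ (by norm_num),
      ← ENNReal.ofReal_mul (Finset.sum_nonneg fun i _ => by positivity),
      ENNReal.ofReal_rpow_of_nonneg (mul_nonneg (Finset.sum_nonneg fun i _ => by positivity)
        (Finset.sum_nonneg fun i _ => by positivity)) (by norm_num),
      ← ENNReal.ofReal_mul hA0, ← ofReal_norm,
      ENNReal.ofReal_le_ofReal_iff (mul_nonneg hA0 (Real.rpow_nonneg (mul_nonneg
        (Finset.sum_nonneg fun i _ => by positivity)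
        (Finset.sum_nonneg fun i _ => by positivity)) _))] at this
    simpa only [Real.rpow_ofNat, RCLike.norm_conj] using this

end DispersiveForm

/-! ### The TT* argument for step functions -/

section SurfaceTransform

open scoped ENNReal ComplexConjugate

variable {σ : Type*} [Fintype σ]

/-- The Fourier transform `∫ f(x, t) e^{-i(x·ξ + t R(ξ))} dx dt` restricted to the graph of
`R = ∑ j, a j * ξ j ^ k j`. -/
noncomputable def graphFourier (a : σ → ℝ) (k : σ → ℕ) (f : (σ → ℝ) × ℝ → ℂ) (ξ : σ → ℝ) : ℂ :=
  ∫ z, f z * Complex.exp (-Complex.I * ((∑ j, z.1 j * ξ j + z.2 * diagPoly a k ξ : ℝ) : ℂ))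

theorem graphFourier_eq (a : σ → ℝ) (k : σ → ℕ) {f : (σ → ℝ) × ℝ → ℂ} (hf : Integrable f)
    (ξ : σ → ℝ) : graphFourier a k f ξ =
      ∫ t, Complex.exp (-Complex.I * ((t * diagPoly a k ξ : ℝ) : ℂ)) *
        fourierPi (fun x => f (x, t)) ξ := by
  have hint : Integrable (fun z : (σ → ℝ) × ℝ => f z *
      Complex.exp (-Complex.I * ((∑ j, z.1 j * ξ j + z.2 * diagPoly a k ξ : ℝ) : ℂ))) :=
    hf.mul_bdd (c := 1) (Continuous.aestronglyMeasurable (by fun_prop))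
      (Filter.Eventually.of_forall fun z => (norm_cexp_neg_I_mul _).le)
  rw [graphFourier]
  rw [Measure.volume_eq_prod] at hint ⊢
  rw [integral_prod_symm _ hint]
  refine integral_congr_ae (Filter.Eventually.of_forall fun t => ?_)
  simp only [fourierPi]
  rw [← integral_const_mul]
  refine integral_congr_ae (Filter.Eventually.of_forall fun x => ?_)
  simp only []
  rw [mul_left_comm, ← Complex.exp_add]
  congr 2
  push_cast
  ring

/-- The squared modulus of the time integral of u(ξ, t) is the double integral of u(ξ, s) times the
conjugate of u(ξ, t). Integrating in ξ first turns it into `dispForm` at time s - t. The bounds N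
and M serve only absolute convergence, and C depends on neither, so both can be removed later. -/
theorem lintegral_enorm_graphFourier_stepFun_le {a : σ → ℝ} (ha : ∀ j, a j ≠ 0) {k : σ → ℕ}
    (hk : ∀ j, 2 ≤ k j) {p : ℝ} (hp1 : 1 < p) (hp2 : p < 2)
    (hpk : (∑ j, (1 / k j : ℝ)) * (2 / p - 1) = 2 - 2 / p) :
    ∃ C : ℝ≥0∞, C ≠ ∞ ∧ ∀ {N M : ℝ}, 0 ≤ N → ∀ {ι : Type} [Fintype ι]
      {E : ι → Set ((σ → ℝ) × ℝ)}, Pairwise (Function.onFun Disjoint E) →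
      (∀ i, MeasurableSet (E i)) → (∀ i, E i ⊆ cube σ M ×ˢ Set.Icc (-M) M) → ∀ c : ι → ℂ,
      ∫⁻ ξ in cube σ N, ‖graphFourier a k (stepFun c E) ξ‖ₑ ^ (2 : ℝ) ≤
        C * (∫⁻ z, ‖stepFun c E z‖ₑ ^ p) ^ (2 / p) := by
  have hp0 : 0 < p := by linarith
  obtain ⟨C₁, hC₁0, hC₁⟩ := exists_norm_dispForm_stepFun_le ha hk hp1 hp2 hpk
  obtain ⟨C₂, hC₂, hHLS⟩ := hardy_littlewood_sobolev_diagonal hp1 hp2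
  refine ⟨ENNReal.ofReal C₁ * C₂, ENNReal.mul_ne_top ENNReal.ofReal_ne_top hC₂, ?_⟩
  intro N M hN ι _ E hEd hE hEM c
  have hR := continuous_diagPoly a k
  have hcubeM : volume (cube σ M) < ∞ := (isCompact_univ_pi fun _ => isCompact_Icc).measure_lt_top
  -- Time slices of disjoint sets are disjoint, so each f(·, t) is again a step function with the
  -- same coefficients.
  set S : ℝ → ι → Set (σ → ℝ) := fun t i => (fun x => (x, t)) ⁻¹' E i with hS
  have hSm : ∀ t i, MeasurableSet (S t i) := fun t i => measurable_prodMk_right (hE i)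
  have hSsub : ∀ t i, S t i ⊆ cube σ M := fun t i x hx => (hEM i hx).1
  have hSfin : ∀ t i, volume (S t i) ≠ ∞ := fun t i =>
    ((measure_mono (hSsub t i)).trans_lt hcubeM).ne
  have hSd : ∀ t, Pairwise (Function.onFun Disjoint (S t)) := fun t i j hij =>
    (hEd hij).preimage _
  have hEfin : ∀ i, volume (E i) ≠ ∞ := fun i =>
    ((measure_mono (hEM i)).trans_lt (((isCompact_univ_pi fun _ => isCompact_Icc).prod
      isCompact_Icc).measure_lt_top)).ne
  have hfm : Measurable (stepFun c E) := measurable_stepFun hE c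
  set u : (σ → ℝ) → ℝ → ℂ := fun ξ t => Complex.exp (-Complex.I * ((t * diagPoly a k ξ : ℝ) : ℂ)) *
    fourierPi (stepFun c (S t)) ξ with hu
  have hum : StronglyMeasurable (Function.uncurry u) := by
    have h1 : StronglyMeasurable fun q : (σ → ℝ) × ℝ => fourierPi (stepFun c (S q.2)) q.1 := by
      have h2 : StronglyMeasurable fun r : ((σ → ℝ) × ℝ) × (σ → ℝ) => stepFun c E (r.2, r.1.2) *
          Complex.exp (-Complex.I * ((∑ i, r.2 i * r.1.1 i : ℝ) : ℂ)) := by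
        refine StronglyMeasurable.mul
          (hfm.comp (by fun_prop)).stronglyMeasurable (Continuous.stronglyMeasurable (by fun_prop))
      exact h2.integral_prod_right'
    exact (Continuous.stronglyMeasurable (by fun_prop)).mul h1
  set K : ℝ := ∑ i, ‖c i‖ * volume.real (cube σ M) with hK
  have hub : ∀ ξ t, ‖u ξ t‖ ≤ K := by
    intro ξ t
    simp only [hu]
    rw [norm_mul, norm_cexp_neg_I_mul, one_mul]
    refine (norm_fourierPi_le _ _).trans ?_
    rw [integral_norm_stepFun (hSd t) (hSm t) (hSfin t)]
    exact Finset.sum_le_sum fun i _ => mul_le_mul_of_nonneg_left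
      (measureReal_mono (hSsub t i) hcubeM.ne) (norm_nonneg _)
  have hu0 : ∀ ξ t, t ∉ Set.Icc (-M) M → u ξ t = 0 := by
    intro ξ t ht
    have : ∀ i, S t i = ∅ := fun i => Set.eq_empty_of_forall_notMem fun x hx => ht (hEM i hx).2
    simp [hu, fourierPi, stepFun, this]
  set ν : Measure ℝ := volume.restrict (Set.Icc (-M) M) with hν
  have hΦ : ∀ ξ, graphFourier a k (stepFun c E) ξ = ∫ t, u ξ t ∂ν := by
    intro ξ
    rw [graphFourier_eq a k (integrable_stepFun hE hEfin c),
      setIntegral_eq_integral_of_forall_compl_eq_zero (fun t ht => hu0 ξ t ht)]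
    rfl
  set G : (σ → ℝ) → ℝ × ℝ → ℂ := fun ξ q => u ξ q.1 * conj (u ξ q.2) with hG
  have hGint : Integrable (Function.uncurry G)
      ((volume.restrict (cube σ N)).prod (ν.prod ν)) := by
    refine Integrable.of_bound (C := K * K) (StronglyMeasurable.aestronglyMeasurable ?_)
      (Filter.Eventually.of_forall fun q => ?_)
    · have h1 : StronglyMeasurable fun q : (σ → ℝ) × ℝ × ℝ => u q.1 q.2.1 :=
        hum.comp_measurable (g := fun q : (σ → ℝ) × ℝ × ℝ => (q.1, q.2.1)) (by fun_prop)
      have h2 : StronglyMeasurable fun q : (σ → ℝ) × ℝ × ℝ => u q.1 q.2.2 :=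
        hum.comp_measurable (g := fun q : (σ → ℝ) × ℝ × ℝ => (q.1, q.2.2)) (by fun_prop)
      exact h1.mul (Complex.continuous_conj.comp_stronglyMeasurable h2)
    · simp only [Function.uncurry, hG]
      rw [norm_mul, RCLike.norm_conj]
      exact mul_le_mul (hub _ _) (hub _ _) (norm_nonneg _) ((norm_nonneg _).trans (hub 0 0))
  have hGG : ∀ ξ, ∫ q, G ξ q ∂(ν.prod ν) =
      ((‖graphFourier a k (stepFun c E) ξ‖ ^ 2 : ℝ) : ℂ) := by
    intro ξ
    simp only [hG]
    rw [integral_prod_mul (fun s => u ξ s) (fun t => conj (u ξ t)), integral_conj, ← hΦ,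
      Complex.mul_conj, Complex.normSq_eq_norm_sq]
  have hdisp : ∀ q : ℝ × ℝ, ∫ ξ in cube σ N, G ξ q =
      dispForm a k N (q.1 - q.2) (stepFun c (S q.1)) (stepFun c (S q.2)) := by
    intro q
    rw [dispForm]
    refine integral_congr_ae (Filter.Eventually.of_forall fun ξ => ?_)
    simp only [hG, hu]
    rw [map_mul, ← Complex.exp_conj, map_mul, map_neg, Complex.conj_I, Complex.conj_ofReal,
      mul_mul_mul_comm, ← Complex.exp_add]
    congr 2
    push_cast
    ring
  -- The spatial Lᵖ norm at time t is the function fed to Hardy–Littlewood–Sobolev. By Tonelli, its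
  -- p-th power integrates to that of the full Lᵖ norm.
  set F : ℝ → ℝ≥0∞ := fun t => (∫⁻ x, ‖stepFun c E (x, t)‖ₑ ^ p) ^ (1 / p) with hF
  have hFm : Measurable F := by
    have : Measurable fun z => ‖stepFun c E z‖ₑ ^ p := by fun_prop
    exact (this.lintegral_prod_left').pow_const _
  have hFeq : ∀ t, F t = ENNReal.ofReal ((∑ i, ‖c i‖ ^ p * volume.real (S t i)) ^ (1 / p)) := by
    intro t
    rw [← ENNReal.ofReal_rpow_of_nonneg (Finset.sum_nonneg fun i _ => by positivity)
      (by positivity), ← lintegral_enorm_stepFun_rpow (hSd t) (hSm t) (hSfin t) c hp0]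
    rfl
  have hFp : ∀ t, F t ^ p = ∫⁻ x, ‖stepFun c E (x, t)‖ₑ ^ p := fun t => by
    rw [hF, ← ENNReal.rpow_mul, one_div_mul_cancel hp0.ne', ENNReal.rpow_one]
  have hFint : ∫⁻ t, F t ^ p = ∫⁻ z, ‖stepFun c E z‖ₑ ^ p := by
    simp only [hFp]
    rw [Measure.volume_eq_prod, lintegral_prod_symm']
    fun_prop
  have hFtop : ∫⁻ t, F t ^ p ≠ ∞ := by
    rw [hFint, lintegral_enorm_stepFun_rpow hEd hE hEfin c hp0]
    exact ENNReal.ofReal_ne_top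
  have hbound : ∀ s t, t ≠ s →
      ‖dispForm a k N (s - t) (stepFun c (S s)) (stepFun c (S t))‖ₑ ≤
      ENNReal.ofReal C₁ * (F s * F t * ENNReal.ofReal (|t - s| ^ (-(2 - 2 / p)))) := by
    intro s t hst
    have h := hC₁ hN (sub_ne_zero.2 hst.symm) (hSd s) (hSm s) (hSfin s) (hSd t) (hSm t) (hSfin t) c c
    rw [← ofReal_norm, hFeq, hFeq, ← ENNReal.ofReal_mul (Real.rpow_nonneg
      (Finset.sum_nonneg fun i _ => by positivity) _), ← ENNReal.ofReal_mul (mul_nonneg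
        (Real.rpow_nonneg (Finset.sum_nonneg fun i _ => by positivity) _)
        (Real.rpow_nonneg (Finset.sum_nonneg fun i _ => by positivity) _)),
      ← ENNReal.ofReal_mul hC₁0]
    refine ENNReal.ofReal_le_ofReal (h.trans (le_of_eq ?_))
    rw [Real.mul_rpow (Finset.sum_nonneg fun i _ => by positivity)
      (Finset.sum_nonneg fun i _ => by positivity), abs_sub_comm]
    ring
  calc ∫⁻ ξ in cube σ N, ‖graphFourier a k (stepFun c E) ξ‖ₑ ^ (2 : ℝ)
      = ‖∫ ξ in cube σ N, ∫ q, G ξ q ∂(ν.prod ν)‖ₑ := by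
        simp only [hGG]
        have hint : Integrable (fun ξ => ‖graphFourier a k (stepFun c E) ξ‖ ^ 2)
            (volume.restrict (cube σ N)) := by
          have := hGint.integral_prod_left.norm
          simp only [Function.uncurry, hGG, Complex.norm_real, norm_pow, norm_norm] at this
          exact this
        rw [integral_complex_ofReal, ← ofReal_norm, Complex.norm_real, Real.norm_of_nonneg
          (integral_nonneg fun ξ => sq_nonneg _), ofReal_integral_eq_lintegral_ofReal hint
          (Filter.Eventually.of_forall fun ξ => sq_nonneg _)]
        refine lintegral_congr fun ξ => ?_
        rw [ENNReal.ofReal_pow (norm_nonneg _), ofReal_norm, ENNReal.rpow_ofNat]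
    _ = ‖∫ q, dispForm a k N (q.1 - q.2) (stepFun c (S q.1)) (stepFun c (S q.2)) ∂(ν.prod ν)‖ₑ := by
        rw [integral_integral_swap hGint]
        simp only [hdisp]
    _ ≤ ∫⁻ q, ‖dispForm a k N (q.1 - q.2) (stepFun c (S q.1)) (stepFun c (S q.2))‖ₑ ∂(ν.prod ν) :=
        enorm_integral_le_lintegral_enorm _
    _ ≤ ∫⁻ s, ∫⁻ t, ‖dispForm a k N (s - t) (stepFun c (S s)) (stepFun c (S t))‖ₑ ∂ν ∂ν :=
        lintegral_prod_le _
    _ ≤ ∫⁻ s, ∫⁻ t, ‖dispForm a k N (s - t) (stepFun c (S s)) (stepFun c (S t))‖ₑ :=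
        (setLIntegral_le_lintegral _ _).trans
          (lintegral_mono fun s => setLIntegral_le_lintegral _ _)
    _ ≤ ∫⁻ s, ∫⁻ t, ENNReal.ofReal C₁ *
          (F s * F t * ENNReal.ofReal (|t - s| ^ (-(2 - 2 / p)))) := by
        refine lintegral_mono fun s => lintegral_mono_ae ?_
        -- On the diagonal `t = s` the kernel has the default value `0 ^ x = 0` with `x ≠ 0`, so the
        -- bound may fail, but only on a null set.
        filter_upwards [compl_mem_ae_iff.2 (measure_singleton (μ := volume) s)] with t ht
        exact hbound s t ht
    _ = ENNReal.ofReal C₁ * ∫⁻ s, ∫⁻ t, F s * F t * ENNReal.ofReal (|t - s| ^ (-(2 - 2 / p))) := by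
        rw [← lintegral_const_mul' _ _ ENNReal.ofReal_ne_top]
        exact lintegral_congr fun s => lintegral_const_mul' _ _ ENNReal.ofReal_ne_top
    _ ≤ _ := by
        rw [mul_assoc, ← hFint]
        gcongr
        exact hHLS F hFm (fun t => by rw [hFeq]; exact ENNReal.ofReal_ne_top) hFtop

end SurfaceTransform

/-! ### From step functions to integrable functions -/

section GeneralFunctions

open scoped ENNReal
open Filter Topology

/-- A simple function is the step function of its nonzero level sets. -/
theorem SimpleFunc.eq_stepFun {X : Type*} [MeasurableSpace X] (g : SimpleFunc X ℂ) :
    (g : X → ℂ) = stepFun (fun c : {c // c ∈ g.range.erase 0} => (c : ℂ))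
      (fun c => g ⁻¹' {(c : ℂ)}) := by
  ext x
  by_cases hx : g x = 0
  · rw [stepFun, Finset.sum_eq_zero, hx]
    intro c _
    refine Set.indicator_of_notMem (fun hc => (Finset.mem_erase.1 c.2).1 ?_) _
    have hc' : g x = c := hc
    exact hc'.symm.trans hx
  · have hmem : g x ∈ g.range.erase 0 := Finset.mem_erase.2 ⟨hx, g.mem_range_self x⟩
    rw [stepFun, Finset.sum_eq_single (⟨g x, hmem⟩ : {c // c ∈ g.range.erase 0})]
    · simp
    · intro c _ hc
      refine Set.indicator_of_notMem (fun h => hc (Subtype.ext ?_)) _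
      exact Eq.symm h
    · simp

variable {σ : Type*} [Fintype σ]

theorem continuous_graphFourier (a : σ → ℝ) (k : σ → ℕ) {f : (σ → ℝ) × ℝ → ℂ} (hf : Integrable f) :
    Continuous (graphFourier a k f) := by
  have hR := continuous_diagPoly a k
  refine continuous_of_dominated (bound := fun x => ‖f x‖) (fun ξ => ?_) (fun ξ => ?_) hf.norm ?_
  · exact hf.aestronglyMeasurable.mul (Continuous.aestronglyMeasurable (by fun_prop))
  · refine Filter.Eventually.of_forall fun x => ?_
    rw [norm_mul, norm_cexp_neg_I_mul, mul_one]
  · exact Filter.Eventually.of_forall fun x => by fun_prop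

theorem graphFourier_congr_ae (a : σ → ℝ) (k : σ → ℕ) {f g : (σ → ℝ) × ℝ → ℂ}
    (h : f =ᵐ[volume] g) : graphFourier a k f = graphFourier a k g := by
  ext ξ
  exact integral_congr_ae (by filter_upwards [h] with z hz; rw [hz])

/-- The restriction inequality for functions in `L¹ ∩ Lᵖ`. -/
theorem lintegral_enorm_graphFourier_le {a : σ → ℝ} (ha : ∀ j, a j ≠ 0) {k : σ → ℕ}
    (hk : ∀ j, 2 ≤ k j) {p : ℝ} (hp1 : 1 < p) (hp2 : p < 2)
    (hpk : (∑ j, (1 / k j : ℝ)) * (2 / p - 1) = 2 - 2 / p) :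
    ∃ C : ℝ≥0∞, C ≠ ∞ ∧ ∀ f : (σ → ℝ) × ℝ → ℂ, Integrable f →
      ∫⁻ ξ, ‖graphFourier a k f ξ‖ₑ ^ (2 : ℝ) ≤ C * (∫⁻ z, ‖f z‖ₑ ^ p) ^ (2 / p) := by
  have hp0 : 0 < p := by linarith
  obtain ⟨C, hC, hmain⟩ := lintegral_enorm_graphFourier_stepFun_le ha hk hp1 hp2 hpk
  refine ⟨C * (2 ^ p) ^ (2 / p), ENNReal.mul_ne_top hC (ENNReal.rpow_ne_top_of_nonneg
    (by positivity) (ENNReal.rpow_ne_top_of_nonneg hp0.le (by norm_num))), ?_⟩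
  suffices H : ∀ f : (σ → ℝ) × ℝ → ℂ, Integrable f → Measurable f →
      ∫⁻ ξ, ‖graphFourier a k f ξ‖ₑ ^ (2 : ℝ) ≤
        C * (2 ^ p) ^ (2 / p) * (∫⁻ z, ‖f z‖ₑ ^ p) ^ (2 / p) by
    intro f hf
    have hae := hf.aestronglyMeasurable.ae_eq_mk
    rw [graphFourier_congr_ae a k hae, lintegral_congr_ae (g := fun z =>
      ‖hf.aestronglyMeasurable.mk f z‖ₑ ^ p) (by filter_upwards [hae] with z hz; rw [← hz])]
    exact H _ (hf.congr hae) hf.aestronglyMeasurable.stronglyMeasurable_mk.measurable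
  intro f hf hfm
  set B : ℕ → Set ((σ → ℝ) × ℝ) := fun n => cube σ n ×ˢ Set.Icc (-n : ℝ) n with hB
  have hBm : ∀ n, MeasurableSet (B n) := fun n => (measurableSet_cube _).prod measurableSet_Icc
  -- Simple approximations, cut off to growing boxes. They are dominated by 2‖f‖, which costs the
  -- factor `(2 ^ p) ^ (2 / p)`.
  set g : ℕ → SimpleFunc ((σ → ℝ) × ℝ) ℂ := fun n =>
    (SimpleFunc.approxOn f hfm Set.univ 0 (Set.mem_univ _) n).restrict (B n) with hg
  have hgapp : ∀ n z, g n z =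
      (B n).indicator (SimpleFunc.approxOn f hfm Set.univ 0 (Set.mem_univ _) n) z := fun n z => by
    simp only [hg]
    rw [SimpleFunc.restrict_apply _ (hBm n)]
  have hgle : ∀ n z, ‖g n z‖ ≤ 2 * ‖f z‖ := fun n z => by
    rw [hgapp, two_mul]
    exact (norm_indicator_le_norm_self _ _).trans (SimpleFunc.norm_approxOn_zero_le hfm _ z n)
  have hcube : ∀ ξ : σ → ℝ, ∀ᶠ n : ℕ in atTop, ξ ∈ cube σ n := fun ξ => by
    have : ∀ j, ∀ᶠ n : ℕ in atTop, |ξ j| ≤ n := fun j =>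
      tendsto_natCast_atTop_atTop.eventually_ge_atTop _
    filter_upwards [eventually_all.2 this] with n hn j _
    exact abs_le.1 (hn j)
  have hglim : ∀ z, Tendsto (fun n => g n z) atTop (𝓝 (f z)) := fun z => by
    have h1 := SimpleFunc.tendsto_approxOn hfm (s := Set.univ) (Set.mem_univ (0 : ℂ)) (x := z)
      (by simp)
    refine h1.congr' ?_
    filter_upwards [hcube z.1, tendsto_natCast_atTop_atTop.eventually_ge_atTop |z.2|] with n h2 h3
    rw [hgapp, Set.indicator_of_mem]
    exact ⟨h2, abs_le.1 h3⟩
  have hgint : ∀ n, Integrable (g n) := fun n =>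
    (hf.norm.const_mul 2).mono' (g n).measurable.aestronglyMeasurable
      (Eventually.of_forall fun z => hgle n z)
  have hGlim : ∀ ξ, Tendsto (fun n => graphFourier a k (g n) ξ) atTop
      (𝓝 (graphFourier a k f ξ)) := fun ξ => by
    refine tendsto_integral_of_dominated_convergence (fun z => 2 * ‖f z‖) (fun n => ?_)
      (hf.norm.const_mul 2) (fun n => Eventually.of_forall fun z => ?_)
      (Eventually.of_forall fun z => (hglim z).mul_const _)
    · exact (g n).measurable.aestronglyMeasurable.mul
        (Continuous.aestronglyMeasurable (by fun_prop))
    · rw [norm_mul, norm_cexp_neg_I_mul, mul_one]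
      exact hgle n z
  set I : ℝ≥0∞ := ∫⁻ z, ‖f z‖ₑ ^ p with hI
  have hbound : ∀ n : ℕ, ∫⁻ ξ in cube σ n, ‖graphFourier a k (g n) ξ‖ₑ ^ (2 : ℝ) ≤
      C * (2 ^ p) ^ (2 / p) * I ^ (2 / p) := by
    intro n
    rw [SimpleFunc.eq_stepFun (g n)]
    refine (hmain (M := n) (Nat.cast_nonneg n)
      (fun c d hcd => ?_) (fun c => (g n).measurableSet_preimage _) (fun c z hz => ?_) _).trans ?_
    · refine Disjoint.preimage _ (Set.disjoint_singleton.2 fun h => hcd (Subtype.ext h))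
    · by_contra hzB
      have h0 : g n z = 0 := by rw [hgapp, Set.indicator_of_notMem hzB]
      have h1 : g n z = c := hz
      exact (Finset.mem_erase.1 c.2).1 (h1.symm.trans h0)
    · rw [← SimpleFunc.eq_stepFun (g n), mul_assoc,
        ← ENNReal.mul_rpow_of_nonneg _ _ (by positivity : 0 ≤ 2 / p)]
      gcongr
      rw [hI, ← lintegral_const_mul' _ _ (ENNReal.rpow_ne_top_of_nonneg hp0.le (by norm_num))]
      refine lintegral_mono fun z => ?_
      rw [← ENNReal.mul_rpow_of_nonneg _ _ hp0.le]
      refine ENNReal.rpow_le_rpow ?_ hp0.le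
      rw [← ofReal_norm, ← ofReal_norm, ← ENNReal.ofReal_ofNat, ← ENNReal.ofReal_mul (by norm_num)]
      exact ENNReal.ofReal_le_ofReal (hgle n z)
  have hmeas : ∀ n : ℕ, Measurable ((cube σ n).indicator fun ξ =>
      ‖graphFourier a k (g n) ξ‖ₑ ^ (2 : ℝ)) := fun n =>
    ((continuous_graphFourier a k (hgint n)).enorm.measurable.pow_const _).indicator
      (measurableSet_cube _)
  -- Fatou's lemma, with the frequency cube and the approximation index growing together.
  calc ∫⁻ ξ, ‖graphFourier a k f ξ‖ₑ ^ (2 : ℝ)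
      = ∫⁻ ξ, liminf (fun n : ℕ => (cube σ n).indicator (fun ξ =>
          ‖graphFourier a k (g n) ξ‖ₑ ^ (2 : ℝ)) ξ) atTop := by
        refine lintegral_congr fun ξ => (Tendsto.liminf_eq ?_).symm
        have h1 := ((ENNReal.continuous_rpow_const (y := 2)).tendsto _).comp
          ((continuous_enorm.tendsto _).comp (hGlim ξ))
        refine h1.congr' ?_
        filter_upwards [hcube ξ] with n hn
        rw [Set.indicator_of_mem hn]
        rfl
    _ ≤ liminf (fun n : ℕ => ∫⁻ ξ, (cube σ n).indicator (fun ξ =>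
          ‖graphFourier a k (g n) ξ‖ₑ ^ (2 : ℝ)) ξ) atTop := lintegral_liminf_le hmeas
    _ ≤ _ := by
        refine liminf_le_of_le (by isBoundedDefault) fun b hb => ?_
        obtain ⟨n, hn⟩ := hb.exists
        refine hn.trans ?_
        rw [lintegral_indicator (measurableSet_cube _)]
        exact hbound n

end GeneralFunctions

/-! ### Transport to Euclidean space -/

section Transport

open scoped ENNReal

/-- The splitting `x ↦ ((x₁, …, xₘ), xₘ₊₁)` of `ℝᵐ⁺¹`. -/
def splitLast (m : ℕ) : EuclideanSpace ℝ (Fin (m + 1)) ≃ᵐ (Fin m → ℝ) × ℝ :=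
  ((MeasurableEquiv.toLp 2 (Fin (m + 1) → ℝ)).symm.trans
    (MeasurableEquiv.piFinSuccAbove (fun _ => ℝ) (Fin.last m))).trans MeasurableEquiv.prodComm

theorem splitLast_apply {m : ℕ} (x : EuclideanSpace ℝ (Fin (m + 1))) :
    splitLast m x = (fun j => x j.castSucc, x (Fin.last m)) := by
  simp [splitLast, MeasurableEquiv.piFinSuccAbove, MeasurableEquiv.prodComm, Fin.insertNthEquiv]
  rfl

theorem measurePreserving_splitLast (m : ℕ) : MeasurePreserving (splitLast m) := by
  have h1 := PiLp.volume_preserving_ofLp (Fin (m + 1))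
  have h2 := volume_preserving_piFinSuccAbove (fun _ : Fin (m + 1) => ℝ) (Fin.last m)
  have h3 : MeasurePreserving (Prod.swap : ℝ × (Fin m → ℝ) → (Fin m → ℝ) × ℝ) volume volume :=
    Measure.measurePreserving_swap
  exact h3.comp (h2.comp h1)

theorem fourierHat_graphPoint {m : ℕ} (a : Fin m → ℝ) (k : Fin m → ℕ)
    (φ : EuclideanSpace ℝ (Fin (m + 1)) → ℂ) (ξ : EuclideanSpace ℝ (Fin m)) :
    fourierHat φ (graphPoint (monomialSum a k) ξ) =
      (((2 * Real.pi) ^ (-((m + 1 : ℕ) : ℝ) / 2) : ℝ) : ℂ) *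
        graphFourier a k (φ ∘ (splitLast m).symm) ξ.ofLp := by
  rw [fourierHat, graphFourier, ← (measurePreserving_splitLast m).integral_comp
    (splitLast m).measurableEmbedding]
  congr 1
  refine integral_congr_ae (Filter.Eventually.of_forall fun x => ?_)
  simp only [Function.comp_apply, MeasurableEquiv.symm_apply_apply]
  congr 3
  rw [splitLast_apply, Fin.sum_univ_castSucc]
  simp [graphPoint, monomialSum, diagPoly]

theorem continuous_fourierHat_graphPoint {m : ℕ} (a : Fin m → ℝ) (k : Fin m → ℕ)
    {φ : EuclideanSpace ℝ (Fin (m + 1)) → ℂ} (hφ : Integrable φ) :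
    Continuous fun ξ => fourierHat φ (graphPoint (monomialSum a k) ξ) := by
  simp only [fourierHat_graphPoint]
  have hi : Integrable (φ ∘ (splitLast m).symm) :=
    (measurePreserving_splitLast m).symm.integrable_comp_of_integrable hφ
  have := continuous_graphFourier a k hi
  fun_prop

theorem exists_eLpNorm_fourierHat_graphPoint_le {m : ℕ} {a : Fin m → ℝ} (ha : ∀ j, a j ≠ 0)
    {k : Fin m → ℕ} (hk : ∀ j, 2 ≤ k j) {p : ℝ} (hp1 : 1 < p) (hp2 : p < 2)
    (hpk : (∑ j, (1 / k j : ℝ)) * (2 / p - 1) = 2 - 2 / p) :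
    ∃ C : ℝ≥0∞, C ≠ ∞ ∧ ∀ φ : EuclideanSpace ℝ (Fin (m + 1)) → ℂ, Integrable φ →
      eLpNorm (fun ξ => fourierHat φ (graphPoint (monomialSum a k) ξ)) 2 volume ≤
        C * eLpNorm φ (ENNReal.ofReal p) volume := by
  have hp0 : 0 < p := by linarith
  obtain ⟨C, hC, h⟩ := lintegral_enorm_graphFourier_le ha hk hp1 hp2 hpk
  set A : ℂ := (((2 * Real.pi) ^ (-((m + 1 : ℕ) : ℝ) / 2) : ℝ) : ℂ) with hA
  refine ⟨‖A‖ₑ * C ^ (1 / 2 : ℝ), ENNReal.mul_ne_top enorm_ne_top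
    (ENNReal.rpow_ne_top_of_nonneg (by norm_num) hC), fun φ hφ => ?_⟩
  have hi : Integrable (φ ∘ (splitLast m).symm) :=
    (measurePreserving_splitLast m).symm.integrable_comp_of_integrable hφ
  have h1 := h _ hi
  have h2 : ∫⁻ z, ‖(φ ∘ (splitLast m).symm) z‖ₑ ^ p = ∫⁻ x, ‖φ x‖ₑ ^ p :=
    (measurePreserving_splitLast m).symm.lintegral_comp_emb
      (splitLast m).symm.measurableEmbedding (fun x => ‖φ x‖ₑ ^ p)
  have h3 : ∫⁻ ξ : EuclideanSpace ℝ (Fin m),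
      ‖graphFourier a k (φ ∘ (splitLast m).symm) ξ.ofLp‖ₑ ^ (2 : ℝ) =
      ∫⁻ ξ, ‖graphFourier a k (φ ∘ (splitLast m).symm) ξ‖ₑ ^ (2 : ℝ) :=
    (PiLp.volume_preserving_ofLp (Fin m)).lintegral_comp_emb
      (MeasurableEquiv.toLp 2 (Fin m → ℝ)).symm.measurableEmbedding
      (fun ξ => ‖graphFourier a k (φ ∘ (splitLast m).symm) ξ‖ₑ ^ (2 : ℝ))
  rw [h2] at h1
  have hcm : (fun ξ => fourierHat φ (graphPoint (monomialSum a k) ξ)) =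
      A • fun ξ : EuclideanSpace ℝ (Fin m) =>
        graphFourier a k (φ ∘ (splitLast m).symm) ξ.ofLp := by
    ext ξ; exact fourierHat_graphPoint a k φ ξ
  rw [hcm, eLpNorm_const_smul, mul_assoc]
  refine mul_le_mul_right ?_ _
  rw [eLpNorm_eq_lintegral_rpow_enorm_toReal (by norm_num) (by norm_num),
    eLpNorm_eq_lintegral_rpow_enorm_toReal (by simpa using hp0) ENNReal.ofReal_ne_top,
    ENNReal.toReal_ofReal hp0.le, ENNReal.toReal_ofNat, h3]
  refine (ENNReal.rpow_le_rpow h1 (by norm_num : (0 : ℝ) ≤ 1 / 2)).trans (le_of_eq ?_)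
  rw [ENNReal.mul_rpow_of_nonneg _ _ (by norm_num : (0 : ℝ) ≤ 1 / 2), ← ENNReal.rpow_mul]
  congr 2
  field_simp

/-! ### Bounded extension to Lᵖ -/

theorem fourierHat_congr_ae {n : ℕ} {f g : EuclideanSpace ℝ (Fin n) → ℂ} (h : f =ᵐ[volume] g)
    (ξ : EuclideanSpace ℝ (Fin n)) : fourierHat f ξ = fourierHat g ξ := by
  rw [fourierHat, fourierHat]
  congr 1
  exact integral_congr_ae (by filter_upwards [h] with x hx; rw [hx])

theorem integrable_mul_cexp_sum {n : ℕ} {f : EuclideanSpace ℝ (Fin n) → ℂ} (hf : Integrable f)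
    (ξ : EuclideanSpace ℝ (Fin n)) :
    Integrable fun x => f x * Complex.exp (-Complex.I * ((∑ i, x i * ξ i : ℝ) : ℂ)) :=
  hf.mul_bdd (c := 1) (Continuous.aestronglyMeasurable (by fun_prop))
    (Filter.Eventually.of_forall fun _ => (norm_cexp_neg_I_mul _).le)

theorem fourierHat_add {n : ℕ} {f g : EuclideanSpace ℝ (Fin n) → ℂ} (hf : Integrable f)
    (hg : Integrable g) (ξ : EuclideanSpace ℝ (Fin n)) :
    fourierHat (f + g) ξ = fourierHat f ξ + fourierHat g ξ := by
  simp only [fourierHat, Pi.add_apply, add_mul]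
  rw [integral_add (integrable_mul_cexp_sum hf ξ) (integrable_mul_cexp_sum hg ξ), mul_add]

theorem fourierHat_smul {n : ℕ} (c : ℂ) (f : EuclideanSpace ℝ (Fin n) → ℂ)
    (ξ : EuclideanSpace ℝ (Fin n)) : fourierHat (c • f) ξ = c * fourierHat f ξ := by
  simp only [fourierHat, Pi.smul_apply, smul_eq_mul, mul_assoc]
  rw [integral_const_mul]
  ring

/-- The integrable functions, as a subspace of `Lᵖ`. -/
def integrableSubmodule {X : Type*} [MeasurableSpace X] (μ : Measure X) (p : ℝ≥0∞) :
    Submodule ℂ (Lp ℂ p μ) where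
  carrier := {φ | Integrable φ μ}
  add_mem' {φ ψ} hφ hψ := (Integrable.add hφ hψ).congr (Lp.coeFn_add φ ψ).symm
  zero_mem' := (integrable_zero _ _ _).congr (Lp.coeFn_zero _ _ _).symm
  smul_mem' c φ hφ := (Integrable.smul c hφ).congr (Lp.coeFn_smul c φ).symm

/-- Simple functions are dense in Lᵖ for finite p, and a simple function in Lᵖ lives on a set of
finite measure, hence is integrable. -/
theorem denseRange_subtype_integrableSubmodule {X : Type*} [MeasurableSpace X] (μ : Measure X)
    {p : ℝ≥0∞} [hp : Fact (1 ≤ p)] (hp_top : p ≠ ∞) :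
    DenseRange (integrableSubmodule μ p).subtype := by
  have h1 := Lp.simpleFunc.dense (E := ℂ) (μ := μ) hp_top
  have h2 : Set.range (integrableSubmodule μ p).subtype = (integrableSubmodule μ p : Set _) := by
    ext φ; simp
  rw [DenseRange, h2]
  refine h1.mono fun φ hφ => ?_
  have h3 : Integrable (Lp.simpleFunc.toSimpleFunc ⟨φ, hφ⟩) μ :=
    (SimpleFunc.memLp_iff_integrable (zero_lt_one.trans_le hp.out).ne' hp_top).1
      (Lp.simpleFunc.memLp ⟨φ, hφ⟩)
  exact h3.congr (Lp.simpleFunc.toSimpleFunc_eq_toFun ⟨φ, hφ⟩)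

/-- The restriction of the Fourier transform to a graph, on integrable functions in `Lᵖ`. -/
noncomputable def graphRestriction {m : ℕ} (R : EuclideanSpace ℝ (Fin m) → ℝ) (p : ℝ≥0∞)
    (h : ∀ φ ∈ integrableSubmodule (volume : Measure (EuclideanSpace ℝ (Fin (m + 1)))) p,
      MemLp (fun ξ => fourierHat φ (graphPoint R ξ)) 2 volume) :
    integrableSubmodule (volume : Measure (EuclideanSpace ℝ (Fin (m + 1)))) p →ₗ[ℂ]
      Lp ℂ 2 (volume : Measure (EuclideanSpace ℝ (Fin m))) where
  toFun φ := (h φ φ.2).toLp _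
  map_add' φ ψ := (MemLp.toLp_congr _ ((h φ φ.2).add (h ψ ψ.2)) (.of_forall fun _ =>
    (fourierHat_congr_ae (Lp.coeFn_add φ.1 ψ.1) _).trans (fourierHat_add φ.2 ψ.2 _))).trans
      (MemLp.toLp_add _ _)
  map_smul' c φ := (MemLp.toLp_congr _ ((h φ φ.2).const_smul c) (.of_forall fun _ =>
    (fourierHat_congr_ae (Lp.coeFn_smul c φ.1) _).trans (fourierHat_smul c _ _))).trans
      (MemLp.toLp_const_smul c _)

/-- An a priori bound on `L¹ ∩ Lᵖ` extends to the restriction inequality on `Lᵖ`. -/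
theorem restrictionInequality_of_le {m : ℕ} {R : EuclideanSpace ℝ (Fin m) → ℝ} {p : ℝ}
    (hp : 1 ≤ p)
    (hcont : ∀ φ : EuclideanSpace ℝ (Fin (m + 1)) → ℂ, Integrable φ →
      Continuous fun ξ => fourierHat φ (graphPoint R ξ))
    {C : ℝ≥0∞} (hC : C ≠ ∞) (h : ∀ φ : EuclideanSpace ℝ (Fin (m + 1)) → ℂ, Integrable φ →
      eLpNorm (fun ξ => fourierHat φ (graphPoint R ξ)) 2 volume ≤
        C * eLpNorm φ (ENNReal.ofReal p) volume) :
    RestrictionInequality R p := by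
  have hfact : Fact (1 ≤ ENNReal.ofReal p) := ⟨by simpa using ENNReal.ofReal_le_ofReal hp⟩
  have hmem : ∀ φ ∈ integrableSubmodule (volume : Measure (EuclideanSpace ℝ (Fin (m + 1))))
      (ENNReal.ofReal p), MemLp (fun ξ => fourierHat φ (graphPoint R ξ)) 2 volume := fun φ hφ =>
    ⟨(hcont _ hφ).aestronglyMeasurable, (h _ hφ).trans_lt
      (ENNReal.mul_lt_top hC.lt_top (Lp.eLpNorm_lt_top _))⟩
  set T₀ := graphRestriction R (ENNReal.ofReal p) hmem with hT₀
  set e := (integrableSubmodule (volume : Measure (EuclideanSpace ℝ (Fin (m + 1))))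
    (ENNReal.ofReal p)).subtype with he
  have hnorm : ∀ φ, ‖T₀ φ‖ ≤ C.toReal * ‖e φ‖ := fun φ => by
    refine (Lp.norm_toLp _ (hmem φ φ.2)).trans_le ?_
    rw [Lp.norm_def, ← ENNReal.toReal_mul]
    exact ENNReal.toReal_mono (ENNReal.mul_ne_top hC (Lp.eLpNorm_ne_top _)) (h _ φ.2)
  have hdense : DenseRange e :=
    denseRange_subtype_integrableSubmodule volume ENNReal.ofReal_ne_top
  refine ⟨C.toReal, (T₀.extendOfNorm e).toLinearMap, fun φ hφ => ?_, fun φ => ?_⟩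
  · have h1 : T₀.extendOfNorm e φ = T₀ ⟨φ, hφ⟩ :=
      LinearMap.extendOfNorm_eq hdense ⟨_, hnorm⟩ ⟨φ, hφ⟩
    rw [ContinuousLinearMap.coe_coe, h1]
    exact MemLp.coeFn_toLp (hmem φ hφ)
  · exact LinearMap.norm_extendOfNorm_apply_le hdense _ hnorm φ

end Transport

/-! ### Necessity by anisotropic scaling -/

section Necessity

open scoped ENNReal

/-- The anisotropic box `∏ [0, l^(-1/kⱼ)] × [0, l⁻¹]`. -/
def anisotropicBox {σ : Type*} (k : σ → ℕ) (l : ℝ) : Set ((σ → ℝ) × ℝ) :=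
  (Set.univ.pi fun j => Set.Icc 0 (l ^ (-(1 / k j : ℝ)))) ×ˢ Set.Icc 0 (l ^ (-1 : ℝ))

/-- The dual box `∏ [-δ l^(1/kⱼ), δ l^(1/kⱼ)]`. -/
def dualBox {σ : Type*} (k : σ → ℕ) (δ l : ℝ) : Set (σ → ℝ) :=
  Set.univ.pi fun j => Set.Icc (-(δ * l ^ (1 / k j : ℝ))) (δ * l ^ (1 / k j : ℝ))

variable {σ : Type*} [Fintype σ]

theorem measurableSet_anisotropicBox (k : σ → ℕ) (l : ℝ) : MeasurableSet (anisotropicBox k l) :=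
  (MeasurableSet.univ_pi fun _ => measurableSet_Icc).prod measurableSet_Icc

theorem measurableSet_dualBox (k : σ → ℕ) (δ l : ℝ) : MeasurableSet (dualBox k δ l) :=
  MeasurableSet.univ_pi fun _ => measurableSet_Icc

theorem volume_anisotropicBox (k : σ → ℕ) {l : ℝ} (hl : 0 < l) :
    volume (anisotropicBox k l) = ENNReal.ofReal (l ^ (-(1 + ∑ j, (1 / k j : ℝ)))) := by
  rw [anisotropicBox, Measure.volume_eq_prod, Measure.prod_prod, volume_pi_pi]
  simp only [Real.volume_Icc, sub_zero]
  rw [← ENNReal.ofReal_prod_of_nonneg fun j _ => Real.rpow_nonneg hl.le _,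
    ← Real.rpow_sum_of_pos hl, ← ENNReal.ofReal_mul (Real.rpow_nonneg hl.le _),
    ← Real.rpow_add hl, Finset.sum_neg_distrib]
  congr 2; ring

theorem volume_dualBox (k : σ → ℕ) {δ l : ℝ} (hδ : 0 < δ) (hl : 0 < l) :
    volume (dualBox k δ l) =
      ENNReal.ofReal ((2 * δ) ^ Fintype.card σ * l ^ (∑ j, (1 / k j : ℝ))) := by
  rw [dualBox, volume_pi_pi]
  simp only [Real.volume_Icc]
  rw [← ENNReal.ofReal_prod_of_nonneg fun j _ => by
    have := Real.rpow_nonneg hl.le (1 / k j : ℝ); nlinarith]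
  congr 1
  rw [Real.rpow_sum_of_pos hl, Fintype.card, ← Finset.prod_const, ← Finset.prod_mul_distrib]
  exact Finset.prod_congr rfl fun j _ => by ring

/-- The powers of l cancel coordinate by coordinate: |x_j ξ_j| ≤ δ and |t a_j ξ_j^{k_j}| ≤ δ|a_j|,
the latter because δ^{k_j} ≤ δ. The condition `hδa` absorbs the sum. -/
theorem abs_phase_le_one {a : σ → ℝ} {k : σ → ℕ} (hk : ∀ j, 2 ≤ k j) {δ l : ℝ}
    (hδ : 0 < δ) (hδ1 : δ ≤ 1) (hδa : δ * (∑ j, (1 + |a j|)) ≤ 1) (hl : 0 < l)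
    {z : (σ → ℝ) × ℝ} (hz : z ∈ anisotropicBox k l) {ξ : σ → ℝ} (hξ : ξ ∈ dualBox k δ l) :
    |∑ j, z.1 j * ξ j + z.2 * diagPoly a k ξ| ≤ 1 := by
  have h1 : ∀ j, |z.1 j * ξ j + z.2 * (a j * ξ j ^ k j)| ≤ δ * (1 + |a j|) := by
    intro j
    have hz1 := hz.1 j trivial
    have hz2 := hz.2
    have hξj : |ξ j| ≤ δ * l ^ (1 / k j : ℝ) := abs_le.2 (hξ j trivial)
    have hL : 0 < l ^ (1 / k j : ℝ) := Real.rpow_pos_of_pos hl _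
    have hk0 : (k j : ℝ) ≠ 0 := by have := hk j; positivity
    have hA : |z.1 j * ξ j| ≤ δ := by
      rw [abs_mul, abs_of_nonneg hz1.1]
      calc z.1 j * |ξ j| ≤ l ^ (-(1 / k j : ℝ)) * (δ * l ^ (1 / k j : ℝ)) :=
            mul_le_mul hz1.2 hξj (abs_nonneg _) (Real.rpow_nonneg hl.le _)
        _ = δ := by rw [Real.rpow_neg hl.le]; field_simp
    have hpow : |ξ j| ^ k j ≤ δ * l := by
      calc |ξ j| ^ k j ≤ (δ * l ^ (1 / k j : ℝ)) ^ k j := pow_le_pow_left₀ (abs_nonneg _) hξj _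
        _ = δ ^ k j * l := by
            rw [mul_pow, ← Real.rpow_natCast (l ^ (1 / k j : ℝ)), ← Real.rpow_mul hl.le,
              one_div_mul_cancel hk0, Real.rpow_one]
        _ ≤ δ * l := mul_le_mul_of_nonneg_right
            (pow_le_of_le_one hδ.le hδ1 (by have := hk j; omega)) hl.le
    have hB : |z.2 * (a j * ξ j ^ k j)| ≤ δ * |a j| := by
      rw [abs_mul, abs_mul, abs_pow, abs_of_nonneg hz2.1]
      calc z.2 * (|a j| * |ξ j| ^ k j) ≤ l ^ (-1 : ℝ) * (|a j| * (δ * l)) :=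
            mul_le_mul hz2.2 (mul_le_mul_of_nonneg_left hpow (abs_nonneg _)) (by positivity)
              (Real.rpow_nonneg hl.le _)
        _ = δ * |a j| := by rw [Real.rpow_neg_one]; field_simp
    calc _ ≤ _ := abs_add_le _ _
      _ ≤ δ + δ * |a j| := add_le_add hA hB
      _ = _ := by ring
  have h2 : ∑ j, z.1 j * ξ j + z.2 * diagPoly a k ξ =
      ∑ j, (z.1 j * ξ j + z.2 * (a j * ξ j ^ k j)) := by
    rw [diagPoly, Finset.mul_sum, Finset.sum_add_distrib]
  rw [h2]
  refine (Finset.abs_sum_le_sum_abs _ _).trans ((Finset.sum_le_sum fun j _ => h1 j).trans ?_)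
  rwa [← Finset.mul_sum]

/-- There is no cancellation: with a phase of size at most 1, the real part of the integrand is a
cosine, at least 1 - 1/2. -/
theorem le_norm_graphFourier_indicator {a : σ → ℝ} {k : σ → ℕ} (hk : ∀ j, 2 ≤ k j) {δ l : ℝ}
    (hδ : 0 < δ) (hδ1 : δ ≤ 1) (hδa : δ * (∑ j, (1 + |a j|)) ≤ 1) (hl : 0 < l)
    {ξ : σ → ℝ} (hξ : ξ ∈ dualBox k δ l) :
    1 / 2 * volume.real (anisotropicBox k l) ≤
      ‖graphFourier a k ((anisotropicBox k l).indicator fun _ => 1) ξ‖ := by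
  have hm := measurableSet_anisotropicBox k l
  have hfin : volume (anisotropicBox k l) ≠ ∞ := by
    rw [volume_anisotropicBox k hl]; exact ENNReal.ofReal_ne_top
  have hfin' : IsFiniteMeasure (volume.restrict (anisotropicBox k l)) :=
    ⟨by rw [Measure.restrict_apply_univ]; exact hfin.lt_top⟩
  set θ : (σ → ℝ) × ℝ → ℝ := fun z => ∑ j, z.1 j * ξ j + z.2 * diagPoly a k ξ with hθ
  have hθc : Continuous θ := by fun_prop
  have hint : Integrable (fun z => Complex.exp (-Complex.I * (θ z : ℂ)))
      (volume.restrict (anisotropicBox k l)) :=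
    Integrable.of_bound (C := 1) (Continuous.aestronglyMeasurable (by fun_prop))
      (Filter.Eventually.of_forall fun z => (norm_cexp_neg_I_mul _).le)
  have h1 : graphFourier a k ((anisotropicBox k l).indicator fun _ => 1) ξ =
      ∫ z in anisotropicBox k l, Complex.exp (-Complex.I * (θ z : ℂ)) := by
    rw [graphFourier, ← integral_indicator hm]
    congr 1
    ext z
    by_cases hz : z ∈ anisotropicBox k l <;> simp [hz, hθ]
  rw [h1]
  refine le_trans ?_ (Complex.re_le_norm _)
  have hre := hint.re
  have h2 : (∫ z in anisotropicBox k l, Complex.exp (-Complex.I * (θ z : ℂ))).re =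
      ∫ z in anisotropicBox k l, (Complex.exp (-Complex.I * (θ z : ℂ))).re :=
    (integral_re hint).symm
  rw [h2]
  have h3 : 1 / 2 * volume.real (anisotropicBox k l) = ∫ _ in anisotropicBox k l, (1 / 2 : ℝ) := by
    rw [setIntegral_const, smul_eq_mul, mul_comm]
  rw [h3]
  refine setIntegral_mono_on (integrable_const _) hre hm fun z hz => ?_
  have h4 := abs_phase_le_one hk hδ hδ1 hδa hl hz hξ (a := a)
  have h5 : (Complex.exp (-Complex.I * (θ z : ℂ))).re = Real.cos (θ z) := by
    rw [neg_mul, ← mul_neg, mul_comm, ← Complex.ofReal_neg, Complex.exp_ofReal_mul_I_re,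
      Real.cos_neg]
  have h6 := Real.one_sub_sq_div_two_le_cos (x := θ z)
  have h7 : θ z ^ 2 ≤ 1 := (sq_le_one_iff_abs_le_one _).2 h4
  change 1 / 2 ≤ (Complex.exp (-Complex.I * (θ z : ℂ))).re
  rw [h5]
  linarith

/-- For s ≠ 0 of either sign, l = (C/K + 1)^{1/s} makes the left side equal to C + K, which exceeds
C. -/
theorem eq_zero_of_forall_rpow_le {K C s : ℝ} (hK : 0 < K) (h : ∀ l : ℝ, 0 < l → K * l ^ s ≤ C) :
    s = 0 := by
  by_contra hs
  have hC : 0 < C := (mul_pos hK (Real.rpow_pos_of_pos one_pos s)).trans_le (h 1 one_pos)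
  have h1 := h ((C / K + 1) ^ s⁻¹) (by positivity)
  rw [← Real.rpow_mul (by positivity), inv_mul_cancel₀ hs, Real.rpow_one, mul_add,
    mul_div_cancel₀ _ hK.ne'] at h1
  linarith

theorem exponent_eq_of_restrictionInequality {m : ℕ} {a : Fin m → ℝ} {k : Fin m → ℕ}
    (hk : ∀ j, 2 ≤ k j) {p : ℝ} (hp : 1 ≤ p) (h : RestrictionInequality (monomialSum a k) p) :
    (1 + ∑ j, (1 / k j : ℝ)) / p = 1 + (∑ j, (1 / k j : ℝ)) / 2 := by
  obtain ⟨C, T, hT, hTC⟩ := h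
  have hp0 : 0 < p := by linarith
  set h := ∑ j, (1 / k j : ℝ) with hh
  set S := ∑ j, (1 + |a j|) with hS
  have hS0 : 0 ≤ S := Finset.sum_nonneg fun j _ => by positivity
  -- Adding 1 to the denominator gives δ ≤ 1 and δS ≤ 1 at once, also for S = 0.
  set δ : ℝ := 1 / (1 + S) with hδdef
  have hδ : 0 < δ := by positivity
  have hδ1 : δ ≤ 1 := by rw [hδdef, div_le_one (by positivity)]; linarith
  have hδS : δ * S ≤ 1 := by rw [hδdef, one_div_mul_eq_div, div_le_one (by positivity)]; linarith
  set A : ℝ := (2 * Real.pi) ^ (-((m + 1 : ℕ) : ℝ) / 2) with hA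
  have hA0 : 0 < A := by positivity
  have hemb := (splitLast m).measurableEmbedding
  have hmp := measurePreserving_splitLast m
  set K : ℝ := A * (1 / 2) * ((2 * δ) ^ m) ^ (1 / 2 : ℝ) with hK
  have hK0 : 0 < K := by positivity
  suffices hmain : ∀ l : ℝ, 0 < l → K * l ^ ((1 + h) / p - 1 - h / 2) ≤ C by
    have := eq_zero_of_forall_rpow_le hK0 hmain
    linarith
  intro l hl
  set Q : Set (EuclideanSpace ℝ (Fin (m + 1))) := splitLast m ⁻¹' anisotropicBox k l with hQ
  have hQm : MeasurableSet Q := (splitLast m).measurable (measurableSet_anisotropicBox k l)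
  have hQv : volume Q = ENNReal.ofReal (l ^ (-(1 + h))) := by
    rw [hQ, hmp.measure_preimage_emb hemb, volume_anisotropicBox k hl]
  have hQfin : volume Q ≠ ∞ := by rw [hQv]; exact ENNReal.ofReal_ne_top
  set P : Set (EuclideanSpace ℝ (Fin m)) := WithLp.ofLp ⁻¹' dualBox k δ l with hP
  have hPm : MeasurableSet P :=
    (MeasurableEquiv.toLp 2 (Fin m → ℝ)).symm.measurable (measurableSet_dualBox k δ l)
  have hPv : volume P = ENNReal.ofReal ((2 * δ) ^ m * l ^ h) := by
    rw [hP, (PiLp.volume_preserving_ofLp (Fin m)).measure_preimage_emb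
      (MeasurableEquiv.toLp 2 (Fin m → ℝ)).symm.measurableEmbedding, volume_dualBox k hδ hl,
      Fintype.card_fin]
  have hPfin : volume P ≠ ∞ := by rw [hPv]; exact ENNReal.ofReal_ne_top
  set φ := indicatorConstLp (ENNReal.ofReal p) hQm hQfin (1 : ℂ) with hφ
  have hφae : (φ : EuclideanSpace ℝ (Fin (m + 1)) → ℂ) =ᵐ[volume] Q.indicator fun _ => 1 :=
    indicatorConstLp_coeFn
  have hφint : Integrable φ volume :=
    ((integrable_indicator_iff hQm).2 (integrableOn_const hQfin)).congr hφae.symm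
  have hlow : ∀ ξ ∈ P, A * (1 / 2 * l ^ (-(1 + h))) ≤
      ‖fourierHat φ (graphPoint (monomialSum a k) ξ)‖ := by
    intro ξ hξ
    have hcomp : (Q.indicator fun _ => (1 : ℂ)) ∘ (splitLast m).symm =
        (anisotropicBox k l).indicator fun _ => 1 := by
      ext z
      have hz : (splitLast m).symm z ∈ Q ↔ z ∈ anisotropicBox k l := by
        rw [hQ, Set.mem_preimage, MeasurableEquiv.apply_symm_apply]
      rw [Function.comp_apply]
      by_cases h : z ∈ anisotropicBox k l
      · rw [Set.indicator_of_mem h, Set.indicator_of_mem (hz.2 h)]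
      · rw [Set.indicator_of_notMem h, Set.indicator_of_notMem (mt hz.1 h)]
    rw [fourierHat_congr_ae hφae, fourierHat_graphPoint, hcomp, norm_mul, Complex.norm_real,
      Real.norm_of_nonneg hA0.le]
    refine mul_le_mul_of_nonneg_left ?_ hA0.le
    refine le_trans (le_of_eq ?_) (le_norm_graphFourier_indicator hk hδ hδ1 hδS hl hξ)
    rw [measureReal_def, volume_anisotropicBox k hl, ENNReal.toReal_ofReal (by positivity)]
  set B : ℝ := A * (1 / 2 * l ^ (-(1 + h))) with hB
  have hB0 : 0 < B := by positivity
  -- The lower bound on the dual box is recast as an L² comparison with a constant multiple of its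
  -- indicator, whose norm is explicit.
  have hle : ‖indicatorConstLp 2 hPm hPfin (B : ℂ)‖ ≤ ‖T φ‖ := by
    refine Lp.norm_le_norm_of_ae_le ?_
    filter_upwards [hT φ hφint, indicatorConstLp_coeFn (p := 2) (hs := hPm) (hμs := hPfin)
      (c := (B : ℂ))] with ξ h1 h2
    rw [h1, h2]
    by_cases hξ : ξ ∈ P
    · rw [Set.indicator_of_mem hξ, Complex.norm_real, Real.norm_of_nonneg hB0.le]
      exact hlow ξ hξ
    · rw [Set.indicator_of_notMem hξ, norm_zero]
      exact norm_nonneg _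
  have h1 := hle.trans (hTC φ)
  rw [norm_indicatorConstLp (by norm_num) (by norm_num), hφ,
    norm_indicatorConstLp (by simpa using hp0) ENNReal.ofReal_ne_top, norm_one, one_mul,
    Complex.norm_real, Real.norm_of_nonneg hB0.le, measureReal_def, measureReal_def, hPv, hQv,
    ENNReal.toReal_ofReal (by positivity), ENNReal.toReal_ofReal (by positivity),
    ENNReal.toReal_ofReal hp0.le, ENNReal.toReal_ofNat, Real.mul_rpow (by positivity)
    (by positivity), ← Real.rpow_mul hl.le, ← Real.rpow_mul hl.le] at h1
  have h2 : l ^ ((1 + h) / p - 1 - h / 2) =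
      l ^ (-(1 + h)) * l ^ (h * (1 / 2)) / l ^ (-(1 + h) * (1 / p)) := by
    rw [← Real.rpow_add hl, ← Real.rpow_sub hl]
    congr 1; ring
  rw [h2, mul_div_assoc', div_le_iff₀ (by positivity)]
  refine le_trans (le_of_eq ?_) h1
  rw [hK, hB]; ring

end Necessity

theorem theorem1p3 (m : ℕ) (hm : 1 ≤ m) (a : Fin m → ℝ) (ha : ∀ j, a j ≠ 0)
    (k : Fin m → ℕ) (hk : ∀ j, 2 ≤ k j) (p : ℝ) (hp : 1 ≤ p) :
    RestrictionInequality (monomialSum a k) p ↔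
      p = 2 - 2 / (2 + ∑ j, 1 / (k j : ℝ)) := by
  -- Positivity of the sum, from `m ≥ 1`, places the critical exponent strictly above 1, as
  -- interpolation and Hardy–Littlewood–Sobolev require.
  have hh0 : 0 < ∑ j, 1 / (k j : ℝ) := by
    have : Nonempty (Fin m) := ⟨⟨0, hm⟩⟩
    refine Finset.sum_pos (fun j _ => ?_) Finset.univ_nonempty
    have := hk j
    positivity
  have hp0 : 0 < p := by linarith
  constructor
  · intro h
    have key := exponent_eq_of_restrictionInequality hk hp h
    set s := ∑ j, 1 / (k j : ℝ)
    field_simp at key ⊢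
    linarith
  · intro h
    set s := ∑ j, 1 / (k j : ℝ) with hs
    have hps : p = (2 + 2 * s) / (2 + s) := by rw [h]; field_simp; ring
    have hp1 : 1 < p := by rw [hps, lt_div_iff₀ (by positivity)]; linarith
    have hp2 : p < 2 := by rw [hps, div_lt_iff₀ (by positivity)]; linarith
    have hpk : s * (2 / p - 1) = 2 - 2 / p := by
      rw [hps]; field_simp; ring
    obtain ⟨C, hC, hle⟩ := exists_eLpNorm_fourierHat_graphPoint_le ha hk hp1 hp2 hpk
    exact restrictionInequality_of_le hp
      (fun φ hφ => continuous_fourierHat_graphPoint a k hφ) hC hle
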